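/- **Conventions.** Graphs are finite; parallel edges and loops are allowed. The perfect matching index $\pi(G)\in\mathbb N\cup\{\infty\}$ of a graph $G$ is the least number of perfect matchings of $G$ that together cover all edges of $G$ ($\pi(G)=\infty$ if there is no such covering). When a path is removed from a cubic graph, all edges that are not on the path are retained; their ends formerly incident with removed vertices become free ends (*semiedges*). The *junction* of two semiedges identifies these two free ends, so that two edges become one. **Halin fragments.** Let $G$ be a cubic graph with $\pi(G)\ge 5$ and let $u,v$ be adjacent vertices of $G$. Denote by $D=G_{uv}$ the result of removing the path $uv$ from $G$; its two semiedges formerly incident with $u$ form the input connector, its two semiedges formerly incident with $v$ form the output connector. Let $G'$ be a bipartite cubic graph and let $u'w'v'$ be a path of length $2$ in $G'$. Denote by $B=G'_{u'w'v'}$ the result of removing this path from $G'$; its two semiedges formerly incident with $u'$ form the input connector, the two formerly incident with $v'$ form the output connector, and the one formerly incident with $w'$ is the residual semiedge. A *Halin fragment* $F=D\circ B$ arises by joining the two output semiedges of such a $D$ to the two input semiedges of such a $B$, in either of the two possible ways. Its input connector is that of $D$; its output connector and its residual semiedge are those of $B$. **Halin snarks.** A *cubic Halin graph* $H=C\cup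 S$ consists of a plane tree $S$ in which every vertex has valency $1$ or $3$, with at least one vertex of valency $3$, and of a circuit $C=(v_0v_1\dots v_{k-1})$ through all the leaves of $S$, taken in the cyclic order in which they occur along the boundary walk of $S$ (so that $H$ is a plane graph). A *Halin snark* is a graph obtained from a cubic Halin graph $H=C\cup S$ and arbitrary Halin fragments $F_0,\dots,F_{k-1}$ as follows: for each $i$ modulo $k$ join the two output semiedges of $F_i$ to the two input semiedges of $F_{i+1}$, in either of the two possible ways; then remove the leaves $v_0,\dots,v_{k-1}$ from $S$, retaining the dangling edges, and join for each $i$ the residual semiedge of $F_i$ to the semiedge of $S$ formerly incident with $v_i$. **Theorem.** Every Halin snark $K$ satisfies $\pi(K)\ge 5$. -/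

import Mathlib

universe u

/-- A finite multipole.  Every edge has two ends, exchanged by the involution `mate`; an end `e` is
either incident with the vertex `x` (`vert e = some x`) or free (`vert e = none`).  The free ends
are the semiedges.  Parallel edges and loops are allowed. -/
structure Multipole where
  V : Type u
  E : Type u
  [finV : Finite V]
  [finE : Finite E]
  vert : E → Option V
  mate : E → E
  mate_mate : ∀ e, mate (mate e) = e
  mate_ne : ∀ e, mate e ≠ e

attribute [instance] Multipole.finV Multipole.finE

namespace Multipole

/-- A graph is a multipole without semiedges. -/
def IsGraph (M : Multipole.{u}) : Prop := ∀ e, M.vert e ≠ none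

/-- A cubic graph: every vertex is incident with exactly three edge ends (so that a loop counts
twice). -/
def IsCubicGraph (M : Multipole.{u}) : Prop :=
  M.IsGraph ∧ ∀ x : M.V, Nat.card {e : M.E // M.vert e = some x} = 3

/-- The vertices have a proper colouring with two colours. -/
def IsBipartite (M : Multipole.{u}) : Prop :=
  ∃ c : M.V → Bool, ∀ (e : M.E) (x y : M.V),
    M.vert e = some x → M.vert (M.mate e) = some y → c x ≠ c y

/-- A set of edges, given as the set `F` of all their ends, is a perfect matching if every vertex
is incident with exactly one end in `F`. -/
def IsPerfectMatching (M : Multipole.{u}) (F : Set M.E) : Prop :=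
  (∀ e ∈ F, M.mate e ∈ F) ∧ ∀ x : M.V, ∃! e : M.E, e ∈ F ∧ M.vert e = some x

/-- The edges of `M` can be covered with `m` perfect matchings. -/
def CoveredBy (M : Multipole.{u}) (m : ℕ) : Prop :=
  ∃ F : Fin m → Set M.E, (∀ i, M.IsPerfectMatching (F i)) ∧ ∀ e, ∃ i, e ∈ F i

/-- The perfect matching index: the least number of perfect matchings that cover all edges
(`⊤` if there is no such covering). -/
noncomputable def perfectMatchingIndex (M : Multipole.{u}) : ℕ∞ :=
  ⨅ (m : ℕ) (_ : M.CoveredBy m), (m : ℕ∞)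

open Classical in
/-- Remove the vertices in `R` and the edges whose ends form `P`.  The remaining edges are all
retained; their ends formerly incident with a vertex in `R` become semiedges. -/
noncomputable def delete (M : Multipole.{u}) (R : Set M.V) (P : Set M.E)
    (hP : ∀ e, M.mate e ∈ P → e ∈ P) : Multipole.{u} where
  V := {x : M.V // x ∉ R}
  E := {e : M.E // e ∉ P}
  vert e := (M.vert e.1).bind fun x => if h : x ∈ R then none else some ⟨x, h⟩
  mate e := ⟨M.mate e.1, fun h => e.2 (hP _ h)⟩
  mate_mate e := Subtype.ext (M.mate_mate e.1)
  mate_ne e h := M.mate_ne e.1 (congrArg Subtype.val h)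

/-- The disjoint union of two multipoles. -/
def sum (M N : Multipole.{u}) : Multipole.{u} where
  V := M.V ⊕ N.V
  E := M.E ⊕ N.E
  vert := Sum.elim (fun e => (M.vert e).map Sum.inl) (fun e => (N.vert e).map Sum.inr)
  mate := Sum.map M.mate N.mate
  mate_mate := by
    rintro (e | e)
    · simp [M.mate_mate]
    · simp [N.mate_mate]
  mate_ne := by
    rintro (e | e)
    · simp [M.mate_ne]
    · simp [N.mate_ne]

/-- The disjoint union of a finite family of multipoles. -/
def sigma {ι : Type u} [Finite ι] (M : ι → Multipole.{u}) : Multipole.{u} where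
  V := Σ i, (M i).V
  E := Σ i, (M i).E
  vert e := ((M e.1).vert e.2).map (Sigma.mk e.1)
  mate e := ⟨e.1, (M e.1).mate e.2⟩
  mate_mate e := by simp [(M e.1).mate_mate]
  mate_ne e h := by
    rcases e with ⟨i, e⟩
    exact (M i).mate_ne e (eq_of_heq (Sigma.mk.inj h).2)

/-- A simple graph as a multipole: the dart from `x` to `y` is the end of the edge `xy` at `x`. -/
def ofSimpleGraph {V : Type u} [Finite V] (S : SimpleGraph V) : Multipole.{u} where
  V := V
  E := S.Dart
  finE := Finite.of_injective (fun d : S.Dart => d.toProd) SimpleGraph.Dart.toProd_injective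
  vert d := some d.fst
  mate d := d.symm
  mate_mate d := d.symm_symm
  mate_ne d := d.symm_ne

/-- `K` is (isomorphic to) the graph that arises from `M` by junctions: `W s t` says that the free
end `s` is identified with the free end `t`.  Two ends incident with vertices are the two ends of
one edge of `K` exactly if they are linked by edges of `M` and identifications of free ends; the
incidences are inherited from `M`. -/
def IsJunction (M : Multipole.{u}) (W : M.E → M.E → Prop) (K : Multipole.{u}) : Prop :=
  ∃ (fV : K.V ≃ M.V) (fE : K.E ≃ {e : M.E // M.vert e ≠ none}),
    (∀ e : K.E, M.vert (fE e).1 = (K.vert e).map fV) ∧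
    ∀ e e' : K.E,
      Relation.EqvGen (fun s t => t = M.mate s ∨ W s t) (fE e).1 (fE e').1 ↔
        e' = e ∨ e' = K.mate e

end Multipole

/-- A cubic graph `G` with perfect matching index at least `5` and adjacent vertices `u`, `v`,
joined by an edge with end `e` at `u` and the other end at `v`. -/
structure Decollineator where
  G : Multipole.{u}
  cubic : G.IsCubicGraph
  index : 5 ≤ G.perfectMatchingIndex
  u : G.V
  v : G.V
  e : G.E
  u_ne_v : u ≠ v
  vert_e : G.vert e = some u
  vert_mate_e : G.vert (G.mate e) = some v

namespace Decollineator

/-- The multipole `G_{uv}`: the path `uv` is removed, and all other edges are retained. -/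
noncomputable def pole (D : Decollineator.{u}) : Multipole.{u} :=
  D.G.delete {D.u, D.v} {D.e, D.G.mate D.e} (by
    rintro a (h | h)
    · exact Or.inr (by rw [Set.mem_singleton_iff, ← h, D.G.mate_mate])
    · exact Or.inl (by rw [← D.G.mate_mate a, Set.mem_singleton_iff.1 h, D.G.mate_mate]))

/-- The input connector: the semiedges formerly incident with `u`. -/
def input (D : Decollineator.{u}) : Set D.pole.E := {a | D.G.vert a.1 = some D.u}

/-- The output connector: the semiedges formerly incident with `v`. -/
def output (D : Decollineator.{u}) : Set D.pole.E := {a | D.G.vert a.1 = some D.v}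

end Decollineator

/-- A bipartite cubic graph `G` with a path `uwv` of length two, whose edges are the edge with ends
`e` at `u` and `G.mate e` at `w`, and the edge with ends `f` at `w` and `G.mate f` at `v`. -/
structure BipartitePole where
  G : Multipole.{u}
  cubic : G.IsCubicGraph
  bipartite : G.IsBipartite
  u : G.V
  w : G.V
  v : G.V
  e : G.E
  f : G.E
  u_ne_w : u ≠ w
  w_ne_v : w ≠ v
  u_ne_v : u ≠ v
  vert_e : G.vert e = some u
  vert_mate_e : G.vert (G.mate e) = some w
  vert_f : G.vert f = some w
  vert_mate_f : G.vert (G.mate f) = some v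

namespace BipartitePole

/-- The multipole `G_{uwv}`: the path `uwv` is removed, and all other edges are retained. -/
noncomputable def pole (B : BipartitePole.{u}) : Multipole.{u} :=
  B.G.delete {B.u, B.w, B.v} ({B.e, B.G.mate B.e} ∪ {B.f, B.G.mate B.f}) (by
    rintro a ((h | h) | (h | h))
    · exact Or.inl (Or.inr (by rw [Set.mem_singleton_iff, ← h, B.G.mate_mate]))
    · exact Or.inl (Or.inl (by
        rw [← B.G.mate_mate a, Set.mem_singleton_iff.1 h, B.G.mate_mate]))
    · exact Or.inr (Or.inr (by rw [Set.mem_singleton_iff, ← h, B.G.mate_mate]))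
    · exact Or.inr (Or.inl (by
        rw [← B.G.mate_mate a, Set.mem_singleton_iff.1 h, B.G.mate_mate])))

/-- The input connector: the semiedges formerly incident with `u`. -/
def input (B : BipartitePole.{u}) : Set B.pole.E := {a | B.G.vert a.1 = some B.u}

/-- The output connector: the semiedges formerly incident with `v`. -/
def output (B : BipartitePole.{u}) : Set B.pole.E := {a | B.G.vert a.1 = some B.v}

/-- The residual semiedge: the one formerly incident with `w`. -/
def residual (B : BipartitePole.{u}) : Set B.pole.E := {a | B.G.vert a.1 = some B.w}

end BipartitePole

/-- A plane tree `S` in which every vertex has valency one or three, and not all have valency one.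
The plane embedding is given by the rotation `rot`, the cyclic permutation of the darts leaving
each vertex. -/
structure PlaneCubicTree where
  V : Type u
  [finV : Finite V]
  S : SimpleGraph V
  isTree : S.IsTree
  valency : ∀ x, (S.neighborSet x).ncard = 1 ∨ (S.neighborSet x).ncard = 3
  exists_trivalent : ∃ x, (S.neighborSet x).ncard = 3
  rot : Equiv.Perm S.Dart
  rot_sameCycle : ∀ d d' : S.Dart, rot.SameCycle d d' ↔ d.fst = d'.fst

attribute [instance] PlaneCubicTree.finV

namespace PlaneCubicTree

def IsLeaf (T : PlaneCubicTree.{u}) (x : T.V) : Prop := (T.S.neighborSet x).ncard = 1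

/-- The leaves of the tree, as a type. -/
abbrev Leaf (T : PlaneCubicTree.{u}) : Type u := {x : T.V // T.IsLeaf x}

/-- One step of the walk along the boundary of the (only) face of the plane tree: having arrived at
a vertex along the dart `d`, leave it along the dart that follows `d.symm` in the rotation. -/
def step (T : PlaneCubicTree.{u}) (d : T.S.Dart) : T.S.Dart := T.rot d.symm

/-- `y` is the first leaf that the boundary walk meets after leaving the leaf `x`. -/
def IsNextLeaf (T : PlaneCubicTree.{u}) (x y : T.Leaf) : Prop :=
  ∃ d : T.S.Dart, d.fst = x.1 ∧ ∃ n : ℕ, (T.step^[n] d).snd = y.1 ∧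
    ∀ m < n, ¬ T.IsLeaf (T.step^[m] d).snd

/-- The multipole obtained from the tree by removing all leaves and retaining all edges; the edge
at each leaf becomes a dangling edge. -/
noncomputable def inner (T : PlaneCubicTree.{u}) : Multipole.{u} :=
  (Multipole.ofSimpleGraph T.S).delete {x | T.IsLeaf x} ∅ (fun _ h => h)

end PlaneCubicTree

/-- A cubic Halin graph `H = C ∪ S`: the plane tree `S` together with the circuit `C` through all
its leaves, in which each leaf `x` is followed by `next x`.  The circuit can be drawn around the
tree so that `H` is plane, which means that consecutive vertices of `C` are consecutive leaves on
the boundary walk of `S`. -/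
structure CubicHalinGraph extends PlaneCubicTree.{u} where
  next : Equiv.Perm toPlaneCubicTree.Leaf
  next_isCycleOn : next.IsCycleOn Set.univ
  next_plane : ∀ x, toPlaneCubicTree.IsNextLeaf x (next x)

/-- The data of the construction of a Halin snark from the cubic Halin graph `H`: each vertex `x`
of the perimeter circuit is substituted by the Halin fragment formed from `D x` and `B x`.  The
output semiedges of `D x` are joined to the input semiedges of `B x` by the bijection `inside`, and
the output semiedges of `B x` to the input semiedges of the next fragment by `between`. -/
structure HalinSnarkData where
  H : CubicHalinGraph.{u}
  D : H.Leaf → Decollineator.{u}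
  B : H.Leaf → BipartitePole.{u}
  inside : ∀ x, (D x).output ≃ (B x).input
  between : ∀ x, (B x).output ≃ (D (H.next x)).input

namespace HalinSnarkData

/-- All building blocks together, before any junction is performed. -/
noncomputable def parts (X : HalinSnarkData.{u}) : Multipole.{u} :=
  (Multipole.sigma fun x => (X.D x).pole).sum
    ((Multipole.sigma fun x => (X.B x).pole).sum X.H.inner)

/-- An edge end of the decollineator at the perimeter vertex `x`. -/
def inD (X : HalinSnarkData.{u}) (x : X.H.Leaf) (a : (X.D x).pole.E) : X.parts.E :=
  Sum.inl ⟨x, a⟩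

/-- An edge end of the bipartite pole at the perimeter vertex `x`. -/
def inB (X : HalinSnarkData.{u}) (x : X.H.Leaf) (a : (X.B x).pole.E) : X.parts.E :=
  Sum.inr (Sum.inl ⟨x, a⟩)

/-- An edge end of the inscribed tree. -/
def inS (X : HalinSnarkData.{u}) (d : X.H.S.Dart) : X.parts.E :=
  Sum.inr (Sum.inr ⟨d, fun h => h⟩)

/-- The junctions of the construction. -/
inductive Weld (X : HalinSnarkData.{u}) : X.parts.E → X.parts.E → Prop
  | inside (x : X.H.Leaf) (a : (X.D x).output) :
      Weld X (X.inD x a.1) (X.inB x (X.inside x a).1)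
  | between (x : X.H.Leaf) (a : (X.B x).output) :
      Weld X (X.inB x a.1) (X.inD (X.H.next x) (X.between x a).1)
  | residual (x : X.H.Leaf) (a : (X.B x).pole.E) (ha : a ∈ (X.B x).residual)
      (d : X.H.S.Dart) (hd : d.fst = x.1) :
      Weld X (X.inB x a) (X.inS d)

end HalinSnarkData

/-- `K` is a Halin snark: it arises from some cubic Halin graph by substituting each vertex of the
perimeter circuit with a Halin fragment. -/
def IsHalinSnark (K : Multipole.{u}) : Prop :=
  K.IsGraph ∧ ∃ X : HalinSnarkData.{u}, X.parts.IsJunction X.Weld K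

/-! Suppose that four perfect matchings cover the snark, and label each edge with the set of
matchings that contain it. At a vertex the three labels are nonempty and partition a four-element
set, so their sizes are 1, 1, 2. Adding the two labels of a connector gives a multiset.

The decollineator preserves the parity of every multiplicity. It also excludes that its two
connectors carry the same multiset when this is the complement of a label: giving that label to `uv`
would cover `G` by four perfect matchings (`Decollineator.isDecollinear`). In the bipartite pole, a
signed count of matching edges shows that input plus output equals the full set plus the residual
label. Together the two facts restrict which input multiset can follow which around the perimeter
(`isTransition_of_fragment`).

What matters about a multiset is its kind: its size and the number of its odd multiplicities. Two
successive transitions, whose residual labels meet at a vertex of the tree, compose to a transition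
for the third label there, and the reverse transition is impossible (`IsTransition.trans`). By
induction from the leaves every branch of the tree acts as a single transition. The three branches
at a trivalent root would form a closed cycle of transitions, which is the contradiction in
`PlaneCubicTree.not_forall_isTransition`.

In base eight no sum of codes used here has a carry. The full set is 585, `&&& 585` reads the
parities of the digits, and the residue modulo 7 is the sum of the digits. -/

/-! ### Arithmetic of coded multisets and transitions -/

/-- The codes of the nonempty subsets of a four-element set with at most two elements.  A multiset
is coded by the number whose digits in base eight are the multiplicities of the four elements. -/
def labelCodes : List ℕ := [1, 8, 64, 512, 9, 65, 513, 72, 520, 576]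

/-- The possible sums of the codes of the two semiedges of a connector. -/
def connectorCodes : List ℕ :=
  [2, 9, 10, 16, 17, 18, 65, 66, 72, 73, 74, 80, 81, 128, 129, 130, 136, 137, 144, 513, 514,
    520, 521, 522, 528, 529, 576, 577, 578, 584, 585, 592, 640, 641, 648, 1024, 1025, 1026,
    1032, 1033, 1040, 1088, 1089, 1096, 1152]

/-- The number of elements that occur an odd number of times in a coded multiset. -/
def oddCount (n : ℕ) : ℕ :=
  (n % 2) + (n / 8 % 2) + (n / 64 % 2) + (n / 512 % 2)

/-- The size of a coded multiset with at most six elements, and the number of its elements of odd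
multiplicity. -/
def kind (n : ℕ) : ℕ × ℕ := (n % 7, oddCount n)

/-- The kinds of the connector codes. -/
def connectorKinds : List (ℕ × ℕ) := [(2, 2), (2, 0), (3, 3), (3, 1), (4, 2), (4, 4), (4, 0)]

/-- All multiplicities in a coded multiset are even. -/
def IsEvenCode (n : ℕ) : Prop := n &&& 585 = 0

instance (n : ℕ) : Decidable (IsEvenCode n) := inferInstanceAs (Decidable (_ = _))

/-- A transition through a decollineator: the flow is preserved and the connectors are not
collinear. -/
def IsDecollinear (n m : ℕ) : Prop :=
  IsEvenCode (n + m) ∧ ¬ (n = m ∧ ∃ z ∈ labelCodes, n + z = 585)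

instance (n m : ℕ) : Decidable (IsDecollinear n m) := inferInstanceAs (Decidable (_ ∧ _))

/-- The possible kinds of the connectors of a chain of Halin fragments with a residual label of
size `s`. -/
def IsKindTransition (s : ℕ) (k l : ℕ × ℕ) : Prop :=
  if s = 1 then
    (k = (4, 2) ∧ l = (3, 1)) ∨ (k = (3, 1) ∧ l = (2, 2))
  else if k.1 = 3 ∨ l.1 = 3 then
    k = (3, 1) ∧ l = (3, 1)
  else
    l.1 = 2 ∨ (k ≠ (2, 2) ∧ k ≠ (4, 4))

instance (s : ℕ) (k l : ℕ × ℕ) : Decidable (IsKindTransition s k l) :=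
  inferInstanceAs (Decidable (ite _ _ _))

/-- The flow condition for connector codes `n`, `m` and a residual label `r`. -/
def IsConserved (r n m : ℕ) : Prop := (n ^^^ m ^^^ (585 ^^^ r)) &&& 585 = 0

instance (r n m : ℕ) : Decidable (IsConserved r n m) := inferInstanceAs (Decidable (_ = _))

/-- A transition from the connector code `n` to the connector code `m` that is possible through a
chain of Halin fragments with residual label `r`. -/
def IsTransition (r n m : ℕ) : Prop :=
  IsConserved r n m ∧ IsKindTransition (r % 7) (kind n) (kind m)

instance (r n m : ℕ) : Decidable (IsTransition r n m) := inferInstanceAs (Decidable (_ ∧ _))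

theorem add_mem_connectorCodes : ∀ a ∈ labelCodes, ∀ b ∈ labelCodes, a + b ∈ connectorCodes := by
  decide

/-- Here `n` and `q` are the codes at the input and output of a decollineator, and `m` is the code
at the next input. Noncollinearity forces an input of kind `(2, 2)` to pass to size 4 and rules out
kind `(3, 3)`. The continuation `m'` is needed to rule out `(3, 3)` for `m` as well. The finitely
many remaining cases follow from `q + m = 585 + r`. -/
theorem isTransition_of_fragment : ∀ m ∈ connectorCodes,
    (∃ m' ∈ connectorCodes, IsDecollinear m m') → ∀ q ∈ connectorCodes, ∀ r ∈ labelCodes,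
    q + m = 585 + r → ∀ n ∈ connectorCodes, IsDecollinear n q → IsTransition r n m := by
  decide +kernel

theorem kind_mem : ∀ n ∈ connectorCodes, kind n ∈ connectorKinds := by
  decide

theorem labelCodes_sizes : ∀ r₁ ∈ labelCodes, ∀ r₂ ∈ labelCodes, ∀ r₃ ∈ labelCodes,
    r₁ + r₂ + r₃ = 585 → (585 ^^^ r₁) ^^^ (585 ^^^ r₂) = 585 ^^^ r₃ ∧
      (r₁ % 7, r₂ % 7, r₃ % 7) ∈ [(1, 1, 2), (1, 2, 1), (2, 1, 1)] := by
  decide +kernel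

/-- Conservation makes the two sets of odd elements differ exactly in the complement of `r`, which
has three elements when `r` is a singleton. -/
theorem oddCount_of_isConserved : ∀ r ∈ labelCodes, r % 7 = 1 → ∀ n ∈ connectorCodes,
    ∀ m ∈ connectorCodes, IsConserved r n m →
      3 ≤ (kind n).2 + (kind m).2 := by
  decide +kernel

/-- The odd-count hypothesis is what kinds alone do not remember: without it, `(3, 1)` to `(2, 2)`
to `(2, 0)` would be a chain with no composite for a third label of size 1. -/
theorem isKindTransition_trans : ∀ s ∈ [(1, 1, 2), (1, 2, 1), (2, 1, 1)],
    ∀ a ∈ connectorKinds, ∀ b ∈ connectorKinds, IsKindTransition s.1 a b →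
    ∀ c ∈ connectorKinds, IsKindTransition s.2.1 b c →
    (s.2.2 = 1 → 3 ≤ a.2 + c.2) →
    IsKindTransition s.2.2 a c ∧ ¬ IsKindTransition s.2.2 c a := by
  decide +kernel

theorem IsConserved.trans {r₁ r₂ r₃ a b c : ℕ} (h : (585 ^^^ r₁) ^^^ (585 ^^^ r₂) = 585 ^^^ r₃)
    (h₁ : IsConserved r₁ a b) (h₂ : IsConserved r₂ b c) : IsConserved r₃ a c := by
  unfold IsConserved at *
  -- The middle code `b` cancels, so the two parity conditions add up to the third.
  have : a ^^^ c ^^^ (585 ^^^ r₃) =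
      (a ^^^ b ^^^ (585 ^^^ r₁)) ^^^ (b ^^^ c ^^^ (585 ^^^ r₂)) := by
    rw [← h]
    apply Nat.eq_of_testBit_eq
    intro i
    simp only [Nat.testBit_xor]
    cases a.testBit i <;> cases b.testBit i <;> cases c.testBit i <;> simp
  rw [this, Nat.and_xor_distrib_right, h₁, h₂, Nat.xor_self]

theorem IsTransition.trans {r₁ r₂ r₃ a b c : ℕ} (hr₁ : r₁ ∈ labelCodes) (hr₂ : r₂ ∈ labelCodes)
    (hr₃ : r₃ ∈ labelCodes) (hr : r₁ + r₂ + r₃ = 585) (ha : a ∈ connectorCodes)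
    (hb : b ∈ connectorCodes) (hc : c ∈ connectorCodes) (h₁ : IsTransition r₁ a b)
    (h₂ : IsTransition r₂ b c) : IsTransition r₃ a c ∧ ¬ IsTransition r₃ c a := by
  obtain ⟨hx, hs⟩ := labelCodes_sizes r₁ hr₁ r₂ hr₂ r₃ hr₃ hr
  have hcons := h₁.1.trans hx h₂.1
  have := isKindTransition_trans _ hs _ (kind_mem a ha) _ (kind_mem b hb) h₁.2 _ (kind_mem c hc)
    h₂.2 (fun h => oddCount_of_isConserved r₃ hr₃ h a ha c hc hcons)
  exact ⟨⟨hcons, this.1⟩, fun h => this.2 h.2⟩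

/-! ### Codes of sets of edge ends -/

/-- The four multiplicities with which the sets `F i` meet `A`, coded in one number. -/
noncomputable def setCode {α : Type*} (F : Fin 4 → Set α) (A : Set α) : ℕ :=
  ∑ i : Fin 4, 8 ^ (i : ℕ) * (A ∩ F i).ncard

theorem setCode_eq {α : Type*} (F : Fin 4 → Set α) (A : Set α) :
    setCode F A = (A ∩ F 0).ncard + 8 * (A ∩ F 1).ncard + 64 * (A ∩ F 2).ncard +
      512 * (A ∩ F 3).ncard := by
  simp [setCode, Fin.sum_univ_four]

theorem setCode_union {α : Type*} [Finite α] (F : Fin 4 → Set α) {A B : Set α}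
    (h : Disjoint A B) : setCode F (A ∪ B) = setCode F A + setCode F B := by
  have key : ∀ i, ((A ∪ B) ∩ F i).ncard = (A ∩ F i).ncard + (B ∩ F i).ncard := fun i => by
    rw [Set.union_inter_distrib_right]
    exact Set.ncard_union_eq (h.mono Set.inter_subset_left Set.inter_subset_left)
      (Set.toFinite _) (Set.toFinite _)
  simp only [setCode, key, mul_add, Finset.sum_add_distrib]

theorem setCode_pair {α : Type*} [Finite α] (F : Fin 4 → Set α) {a b : α} (h : a ≠ b) :
    setCode F {a, b} = setCode F {a} + setCode F {b} := by
  rw [← setCode_union F (Set.disjoint_singleton.2 h), Set.singleton_union]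

theorem setCode_triple {α : Type*} [Finite α] (F : Fin 4 → Set α) {a b c : α} (hab : a ≠ b)
    (hac : a ≠ c) (hbc : b ≠ c) :
    setCode F {a, b, c} = setCode F {a} + setCode F {b} + setCode F {c} := by
  rw [add_assoc, ← setCode_pair F hbc, ← setCode_union, Set.singleton_union]
  simp [hab, hac]

theorem setCode_singleton_congr {α β : Type*} {F : Fin 4 → Set α} {F' : Fin 4 → Set β} {a : α}
    {b : β} (h : ∀ i, a ∈ F i ↔ b ∈ F' i) : setCode F {a} = setCode F' {b} := by
  unfold setCode
  refine Finset.sum_congr rfl fun i _ => ?_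
  by_cases ha : a ∈ F i
  · rw [Set.singleton_inter_of_mem ha, Set.singleton_inter_of_mem ((h i).1 ha)]
    simp
  · rw [Set.singleton_inter_eq_empty.2 ha,
      Set.singleton_inter_eq_empty.2 (fun h' => ha ((h i).2 h'))]
    simp

/-- The codes of all subsets of a four-element set. -/
def subsetCodes : List ℕ :=
  [0, 1, 8, 9, 64, 65, 72, 73, 512, 513, 520, 521, 576, 577, 584, 585]

theorem ncard_singleton_inter {α : Type*} (a : α) (S : Set α) [Decidable (a ∈ S)] :
    ({a} ∩ S : Set α).ncard = if a ∈ S then 1 else 0 := by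
  split_ifs with h
  · simp [Set.singleton_inter_of_mem h]
  · simp [Set.singleton_inter_eq_empty.2 h]

open Classical in
theorem setCode_singleton_mem {α : Type*} (F : Fin 4 → Set α) (a : α) :
    setCode F {a} ∈ subsetCodes := by
  rw [setCode_eq]
  simp only [ncard_singleton_inter]
  split_ifs <;> decide

theorem setCode_singleton_ne_zero {α : Type*} (F : Fin 4 → Set α) (a : α) (h : ∃ i, a ∈ F i) :
    setCode F {a} ≠ 0 := by
  obtain ⟨i, hi⟩ := h
  intro h0
  have := (Finset.sum_eq_zero_iff.1 h0) i (Finset.mem_univ i)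
  rw [Set.singleton_inter_of_mem hi] at this
  simp at this

theorem mem_labelCodes_of_add : ∀ a ∈ subsetCodes, a ≠ 0 → ∀ b ∈ subsetCodes, b ≠ 0 →
    ∀ c ∈ subsetCodes, c ≠ 0 → a + b + c = 585 →
    a ∈ labelCodes ∧ b ∈ labelCodes ∧ c ∈ labelCodes := by
  decide +kernel

/-! ### Matchings in multipoles, their parts and their junctions -/

namespace Multipole

/-- The edge ends at a vertex. -/
def ends (M : Multipole.{u}) (x : M.V) : Set M.E := {e | M.vert e = some x}

/-- A family of four perfect matchings. -/
def IsMatchingFamily (M : Multipole.{u}) (F : Fin 4 → Set M.E) : Prop :=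
  ∀ i, M.IsPerfectMatching (F i)

theorem IsPerfectMatching.ncard_ends_inter {M : Multipole.{u}} {F : Set M.E}
    (h : M.IsPerfectMatching F) (x : M.V) : (M.ends x ∩ F).ncard = 1 := by
  obtain ⟨e, he, hu⟩ := h.2 x
  rw [Set.ncard_eq_one]
  refine ⟨e, Set.eq_singleton_iff_unique_mem.2 ⟨⟨he.2, he.1⟩, fun y hy => hu y ⟨hy.2, hy.1⟩⟩⟩

theorem IsMatchingFamily.setCode_ends {M : Multipole.{u}} {F : Fin 4 → Set M.E}
    (h : M.IsMatchingFamily F) (x : M.V) : setCode F (M.ends x) = 585 := by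
  rw [setCode_eq]
  simp only [(h _).ncard_ends_inter]

/-- The labels of the three ends at a trivalent vertex. -/
theorem IsMatchingFamily.labels_of_ends {M : Multipole.{u}} {F : Fin 4 → Set M.E}
    (h : M.IsMatchingFamily F) {x : M.V} {a b c : M.E} (hab : a ≠ b) (hac : a ≠ c) (hbc : b ≠ c)
    (hx : M.ends x = {a, b, c}) (hcov : ∀ e ∈ M.ends x, ∃ i, e ∈ F i) :
    setCode F {a} + setCode F {b} + setCode F {c} = 585 ∧ setCode F {a} ∈ labelCodes ∧
      setCode F {b} ∈ labelCodes ∧ setCode F {c} ∈ labelCodes := by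
  have hsum := h.setCode_ends x
  rw [hx, setCode_triple F hab hac hbc] at hsum
  rw [hx] at hcov
  exact ⟨hsum, mem_labelCodes_of_add _ (setCode_singleton_mem F a)
    (setCode_singleton_ne_zero F a (hcov a (by simp))) _ (setCode_singleton_mem F b)
    (setCode_singleton_ne_zero F b (hcov b (by simp))) _ (setCode_singleton_mem F c)
    (setCode_singleton_ne_zero F c (hcov c (by simp))) hsum⟩

theorem IsMatchingFamily.label_mem {M : Multipole.{u}} {F : Fin 4 → Set M.E}
    (h : M.IsMatchingFamily F) {x : M.V} (hx : (M.ends x).ncard = 3)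
    (hcov : ∀ e ∈ M.ends x, ∃ i, e ∈ F i) {e : M.E} (he : e ∈ M.ends x) :
    setCode F {e} ∈ labelCodes := by
  obtain ⟨a, b, c, hab, hac, hbc, habc⟩ := Set.ncard_eq_three.1 hx
  obtain ⟨-, ha, hb, hc⟩ := h.labels_of_ends hab hac hbc habc hcov
  rw [habc] at he
  rcases he with rfl | rfl | rfl <;> assumption

theorem IsCubicGraph.ncard_ends {M : Multipole.{u}} (h : M.IsCubicGraph) (x : M.V) :
    (M.ends x).ncard = 3 := by
  rw [← h.2 x, ← Nat.card_coe_set_eq]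
  rfl

/-- `M` is a part of `N` in which all edges and all incidences of the vertices of `M` are
retained. -/
structure IsPart (M N : Multipole.{u}) (f : M.E → N.E) (g : M.V → N.V) : Prop where
  injective : Function.Injective f
  mate : ∀ e, N.mate (f e) = f (M.mate e)
  ends_eq : ∀ x, N.ends (g x) = f '' M.ends x

theorem IsPart.isPerfectMatching {M N : Multipole.{u}} {f : M.E → N.E} {g : M.V → N.V}
    (h : IsPart M N f g) {F : Set N.E} (hF : N.IsPerfectMatching F) :
    M.IsPerfectMatching (f ⁻¹' F) := by
  refine ⟨fun e he => ?_, fun x => ?_⟩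
  · rw [Set.mem_preimage, ← h.mate]
    exact hF.1 _ he
  · obtain ⟨e, ⟨heF, hex⟩, hu⟩ := hF.2 (g x)
    have : e ∈ N.ends (g x) := hex
    rw [h.ends_eq] at this
    obtain ⟨a, ha, rfl⟩ := this
    refine ⟨a, ⟨heF, ha⟩, fun b hb => h.injective (hu _ ⟨hb.1, ?_⟩)⟩
    change f b ∈ N.ends (g x)
    rw [h.ends_eq]
    exact ⟨b, hb.2, rfl⟩

theorem IsPart.trans {L M N : Multipole.{u}} {f : L.E → M.E} {g : L.V → M.V} {f' : M.E → N.E}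
    {g' : M.V → N.V} (h : IsPart L M f g) (h' : IsPart M N f' g') :
    IsPart L N (f' ∘ f) (g' ∘ g) where
  injective := h'.injective.comp h.injective
  mate e := by simp [h'.mate, h.mate]
  ends_eq x := by simp [h'.ends_eq, h.ends_eq, Set.image_image]

theorem isPart_sum_left (M N : Multipole.{u}) : IsPart M (M.sum N) Sum.inl Sum.inl where
  injective := Sum.inl_injective
  mate _ := rfl
  ends_eq x := by
    ext e
    change Sum.elim (fun e => (M.vert e).map Sum.inl) (fun e => (N.vert e).map Sum.inr) e =
      some (Sum.inl x) ↔ ∃ a, M.vert a = some x ∧ Sum.inl a = e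
    rcases e with e | e <;> simp

theorem isPart_sum_right (M N : Multipole.{u}) : IsPart N (M.sum N) Sum.inr Sum.inr where
  injective := Sum.inr_injective
  mate _ := rfl
  ends_eq x := by
    ext e
    change Sum.elim (fun e => (M.vert e).map Sum.inl) (fun e => (N.vert e).map Sum.inr) e =
      some (Sum.inr x) ↔ ∃ a, N.vert a = some x ∧ Sum.inr a = e
    rcases e with e | e <;> simp

theorem isPart_sigma {ι : Type u} [Finite ι] (M : ι → Multipole.{u}) (i : ι) :
    IsPart (M i) (sigma M) (fun e => ⟨i, e⟩) (fun x => ⟨i, x⟩) where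
  injective := sigma_mk_injective (β := fun i => (M i).E)
  mate _ := rfl
  ends_eq x := by
    ext ⟨j, e⟩
    change ((M j).vert e).map (Sigma.mk j) = some (⟨i, x⟩ : Σ i, (M i).V) ↔
      ∃ a, (M i).vert a = some x ∧ (⟨i, a⟩ : Σ i, (M i).E) = ⟨j, e⟩
    rw [Option.map_eq_some_iff]
    constructor
    · rintro ⟨y, hy, h⟩
      obtain ⟨rfl, h⟩ := Sigma.mk.inj h
      obtain rfl := eq_of_heq h
      exact ⟨e, hy, rfl⟩
    · rintro ⟨e', he', h⟩
      obtain ⟨rfl, h⟩ := Sigma.mk.inj h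
      obtain rfl := eq_of_heq h
      exact ⟨x, he', rfl⟩

/-- Perfect matchings of a graph that arises by junctions, seen before the junctions. -/
theorem IsJunction.exists_matchingFamily {M K : Multipole.{u}} {W : M.E → M.E → Prop}
    (h : M.IsJunction W K) {F : Fin 4 → Set K.E} (hF : K.IsMatchingFamily F)
    (hcov : ∀ e, ∃ i, e ∈ F i) :
    ∃ F' : Fin 4 → Set M.E, M.IsMatchingFamily F' ∧
      (∀ s t, W s t → ∀ i, s ∈ F' i ↔ t ∈ F' i) ∧ ∀ e, M.vert e ≠ none → ∃ i, e ∈ F' i := by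
  obtain ⟨fV, fE, hvert, hlink⟩ := h
  set R : M.E → M.E → Prop := fun s t => t = M.mate s ∨ W s t with hR
  -- Each matching is spread over all ends linked to it. A linkage class without an end at a vertex
  -- lies in no `F' i`, so covering is claimed only for ends at vertices.
  let F' : Fin 4 → Set M.E := fun i => {a | ∃ e ∈ F i, Relation.EqvGen R (fE e).1 a}
  have hclosed : ∀ s t, R s t → ∀ i, s ∈ F' i ↔ t ∈ F' i := fun s t hst i =>
    ⟨fun ⟨e, he, h⟩ => ⟨e, he, h.trans _ _ _ (.rel _ _ hst)⟩,
      fun ⟨e, he, h⟩ => ⟨e, he, h.trans _ _ _ (.symm _ _ (.rel _ _ hst))⟩⟩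
  have hmem : ∀ e i, (fE e).1 ∈ F' i ↔ e ∈ F i := by
    refine fun e i => ⟨?_, fun he => ⟨e, he, .refl _⟩⟩
    rintro ⟨e', he', h⟩
    rcases (hlink e' e).1 h with rfl | rfl
    · exact he'
    · exact (hF i).1 _ he'
  refine ⟨F', fun i => ⟨fun e he => (hclosed _ _ (Or.inl rfl) i).1 he, fun x => ?_⟩,
    fun s t hst => hclosed s t (Or.inr hst), fun e he => ?_⟩
  · obtain ⟨e, ⟨heF, hex⟩, hu⟩ := (hF i).2 (fV.symm x)
    refine ⟨(fE e).1, ⟨(hmem e i).2 heF, by simp [hvert, hex]⟩, ?_⟩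
    rintro a ⟨haF, hax⟩
    have ha : M.vert a ≠ none := by simp [hax]
    obtain ⟨e', he'⟩ := fE.surjective ⟨a, ha⟩
    have hae : a = (fE e').1 := by rw [he']
    subst hae
    rw [hu e' ⟨(hmem e' i).1 haF, ?_⟩]
    rw [hvert, Option.map_eq_some_iff] at hax
    obtain ⟨y, hy, rfl⟩ := hax
    simpa using hy
  · obtain ⟨e', he'⟩ := fE.surjective ⟨e, he⟩
    obtain ⟨i, hi⟩ := hcov e'
    refine ⟨i, ?_⟩
    have := (hmem e' i).2 hi
    rwa [he'] at this

theorem CoveredBy.mono {M : Multipole.{u}} {m n : ℕ} (h : M.CoveredBy m) (hm : m ≤ n)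
    (hM : Nonempty M.E) : M.CoveredBy n := by
  obtain ⟨F, hF, hcov⟩ := h
  obtain ⟨i₀, -⟩ := hcov hM.some
  -- The surplus indices repeat one of the given matchings, which exists because some edge has to be
  -- covered.
  refine ⟨fun i => if hi : (i : ℕ) < m then F ⟨i, hi⟩ else F i₀, fun i => ?_, fun e => ?_⟩
  · dsimp only
    split_ifs <;> exact hF _
  · obtain ⟨i, hi⟩ := hcov e
    exact ⟨⟨i, i.2.trans_le hm⟩, by simpa using hi⟩

theorem five_le_perfectMatchingIndex {M : Multipole.{u}} (hM : Nonempty M.E)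
    (h : ¬ M.CoveredBy 4) : 5 ≤ M.perfectMatchingIndex := by
  refine le_iInf₂ fun m hm => ?_
  by_contra hlt
  have : m < 5 := by exact_mod_cast not_le.1 hlt
  exact h (hm.mono (by omega) hM)

theorem not_coveredBy_four {M : Multipole.{u}} (h : 5 ≤ M.perfectMatchingIndex) :
    ¬ M.CoveredBy 4 := fun h4 => by
  have := h.trans (iInf₂_le 4 h4)
  exact absurd (by exact_mod_cast this : 5 ≤ 4) (by norm_num)

open Classical in
/-- If the weights of the two ends of each edge cancel, then the weights of the vertices, each
multiplied by the excess of its valency in a set of edges, add up to zero. -/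
theorem sum_weight_eq_zero {G : Multipole.{u}} (hG : G.IsCubicGraph) [Fintype G.V]
    {A : Type*} [AddCommGroup A] (wt : G.V → A) (h3 : ∀ a : A, 3 • a = 0 → a = 0)
    (hwt : ∀ e x y, G.vert e = some x → G.vert (G.mate e) = some y → wt x + wt y = 0)
    (F : Set G.E) (hF : ∀ e ∈ F, G.mate e ∈ F) :
    ∑ x, (((G.ends x ∩ F).ncard : ℤ) - 1) • wt x = 0 := by
  have : Fintype G.E := Fintype.ofFinite _
  choose vtx hvtx using fun e => Option.ne_none_iff_exists'.1 (hG.1 e)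
  -- Pairing ends by `mate` cancels the total weight of any set of edges. For the set of all ends
  -- this gives three times the sum of the weights, which `h3` turns into zero; the claim is the
  -- difference between the case of `F` and this one.
  have key : ∀ S : Set G.E, (∀ e ∈ S, G.mate e ∈ S) → ∑ x, (G.ends x ∩ S).ncard • wt x = 0 := by
    intro S hS
    have h1 : ∑ e ∈ S.toFinset, wt (vtx e) = 0 := by
      refine Finset.sum_involution (fun e _ => G.mate e) (fun e _ => hwt e _ _ (hvtx e) (hvtx _))
        (fun e _ _ => G.mate_ne e) (fun e he => ?_) (fun e _ => G.mate_mate e)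
      rw [Set.mem_toFinset] at he ⊢
      exact hS e he
    rw [← Finset.sum_fiberwise S.toFinset vtx] at h1
    rw [← h1]
    refine Finset.sum_congr rfl fun x _ => ?_
    have h2 : ∀ e ∈ S.toFinset.filter (fun e => vtx e = x), wt (vtx e) = wt x := fun e he => by
      rw [(Finset.mem_filter.1 he).2]
    rw [Finset.sum_congr rfl h2, Finset.sum_const, ← Set.ncard_coe_finset]
    congr 2
    ext e
    simp [ends, hvtx, and_comm]
  have huniv := key Set.univ fun _ _ => trivial
  simp only [Set.inter_univ, hG.ncard_ends, ← Finset.smul_sum] at huniv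
  have h0 := h3 _ huniv
  have h1 := key F hF
  simp only [sub_smul, one_smul, Finset.sum_sub_distrib, natCast_zsmul, h0, h1, sub_zero]

end Multipole

theorem isEvenCode_of_even : ∀ a b c d : Fin 3,
    IsEvenCode ((a + a : ℕ) + 8 * (b + b : ℕ) + 64 * (c + c : ℕ) + 512 * (d + d : ℕ)) := by
  decide

theorem exists_subset_of_mem_labelCodes : ∀ z ∈ labelCodes, ∃ Z : Fin 4 → Bool,
    (∃ i, Z i = true) ∧
    z = (Z 0).toNat + 8 * (Z 1).toNat + 64 * (Z 2).toNat + 512 * (Z 3).toNat := by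
  decide +kernel

theorem setCode_mem_connectorCodes {α : Type*} [Finite α] {F : Fin 4 → Set α} {A : Set α}
    (hA : A.ncard = 2) (h : ∀ a ∈ A, setCode F {a} ∈ labelCodes) :
    setCode F A ∈ connectorCodes := by
  obtain ⟨a, b, hab, rfl⟩ := Set.ncard_eq_two.1 hA
  rw [setCode_pair F hab]
  exact add_mem_connectorCodes _ (h a (by simp)) _ (h b (by simp))

/-! ### Deleting vertices and edges -/

namespace Multipole

theorem isPerfectMatching_of_ncard {M : Multipole.{u}} {F : Set M.E}
    (h : ∀ e ∈ F, M.mate e ∈ F) (h1 : ∀ x, (M.ends x ∩ F).ncard = 1) : M.IsPerfectMatching F := by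
  refine ⟨h, fun x => ?_⟩
  obtain ⟨e, he⟩ := Set.ncard_eq_one.1 (h1 x)
  have := Set.eq_singleton_iff_unique_mem.1 he
  exact ⟨e, ⟨this.1.2, this.1.1⟩, fun y hy => this.2 y ⟨hy.2, hy.1⟩⟩

section delete

variable {M : Multipole.{u}} {R : Set M.V} {P : Set M.E} {hP : ∀ e, M.mate e ∈ P → e ∈ P}

/-- An edge end that is retained, as an edge end of the original multipole. -/
def deleteEnd (e : (M.delete R P hP).E) : M.E := e.1

/-- A vertex that is retained. -/
def deleteVertex (x : M.V) (hx : x ∉ R) : (M.delete R P hP).V := (⟨x, hx⟩ : {x : M.V // x ∉ R})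

theorem deleteEnd_injective :
    Function.Injective (deleteEnd : (M.delete R P hP).E → M.E) := fun _ _ h => Subtype.ext h

theorem mem_range_deleteEnd {e : M.E} :
    e ∈ Set.range (deleteEnd : (M.delete R P hP).E → M.E) ↔ e ∉ P :=
  ⟨fun ⟨a, h⟩ => h ▸ a.2, fun h => ⟨⟨e, h⟩, rfl⟩⟩

theorem exists_deleteVertex (x : (M.delete R P hP).V) :
    ∃ (y : M.V) (hy : y ∉ R), x = deleteVertex y hy :=
  ⟨x.1, x.2, rfl⟩

theorem delete_vert_eq_some {e : (M.delete R P hP).E} {x : M.V} {hx : x ∉ R} :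
    (M.delete R P hP).vert e = some (deleteVertex x hx) ↔ M.vert (deleteEnd e) = some x := by
  classical
  have key : ∀ o : Option M.V, (o.bind fun x => if h : x ∈ R then none else
      some (⟨x, h⟩ : {x : M.V // x ∉ R})) = some ⟨x, hx⟩ ↔ o = some x := by
    rintro (_ | y)
    · simp
    · rw [Option.bind_some]
      split_ifs with hy
      · simp only [Option.some_inj, false_iff]
        rintro rfl
        exact hx hy
      · simp
  exact key (M.vert (deleteEnd e))

theorem delete_vert_eq_none {e : (M.delete R P hP).E}
    (he : (M.delete R P hP).vert e = none) {x : M.V} (hx : M.vert (deleteEnd e) = some x) :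
    x ∈ R := by
  by_contra h
  have := (delete_vert_eq_some (hx := h)).2 hx
  rw [he] at this
  cases this

theorem delete_ends (x : M.V) (hx : x ∉ R) :
    (M.delete R P hP).ends (deleteVertex x hx) = deleteEnd ⁻¹' M.ends x :=
  Set.ext fun _ => delete_vert_eq_some

theorem ncard_preimage_inter (A : Set M.E) (F : Set (M.delete R P hP).E) :
    (deleteEnd ⁻¹' A ∩ F).ncard = (A ∩ deleteEnd '' F).ncard := by
  rw [← Set.image_preimage_inter, Set.ncard_image_of_injective _ deleteEnd_injective]

theorem ncard_preimage_add (A : Set M.E) :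
    (deleteEnd ⁻¹' A : Set (M.delete R P hP).E).ncard + (A ∩ P).ncard = A.ncard := by
  have : A \ P = deleteEnd '' (deleteEnd ⁻¹' A : Set (M.delete R P hP).E) := by
    rw [Set.image_preimage_eq_inter_range]
    ext e
    rw [Set.mem_inter_iff, mem_range_deleteEnd, Set.mem_sdiff]
  rw [← Set.ncard_image_of_injective _ deleteEnd_injective, ← this, add_comm]
  exact Set.ncard_inter_add_ncard_sdiff_eq_ncard A P (Set.toFinite _)

theorem IsPerfectMatching.ncard_ends_inter_image {F : Set (M.delete R P hP).E}
    (h : (M.delete R P hP).IsPerfectMatching F) {x : M.V} (hx : x ∉ R) :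
    (M.ends x ∩ deleteEnd '' F).ncard = 1 := by
  rw [← ncard_preimage_inter, ← h.ncard_ends_inter (deleteVertex x hx), delete_ends]

theorem IsPerfectMatching.mate_mem_image {F : Set (M.delete R P hP).E}
    (h : (M.delete R P hP).IsPerfectMatching F) (e : M.E) (he : e ∈ deleteEnd '' F) :
    M.mate e ∈ deleteEnd '' F := by
  obtain ⟨a, ha, rfl⟩ := he
  exact ⟨_, h.1 a ha, rfl⟩

theorem delete_ncard_ends (hM : ∀ x ∉ R, (M.ends x).ncard = 3)
    (hPR : ∀ e ∈ P, ∀ x, M.vert e = some x → x ∈ R) (x : (M.delete R P hP).V) :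
    ((M.delete R P hP).ends x).ncard = 3 := by
  obtain ⟨x, hx, rfl⟩ := exists_deleteVertex x
  have h : M.ends x ∩ P = ∅ := by
    rw [← Set.disjoint_iff_inter_eq_empty, Set.disjoint_left]
    exact fun e he heP => hx (hPR e heP _ he)
  rw [delete_ends, ← hM x hx, ← ncard_preimage_add (hP := hP) (R := R), h, Set.ncard_empty]
  rfl

end delete

end Multipole

/-! ### Decollineators: parity and noncollinearity -/

open Multipole

namespace Decollineator

variable (D : Decollineator.{u})

theorem ncard_ends (x : D.pole.V) : (D.pole.ends x).ncard = 3 := by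
  refine delete_ncard_ends (fun x _ => D.cubic.ncard_ends x) ?_ x
  rintro e (rfl | rfl) x hx
  · rw [D.vert_e] at hx; cases hx; exact Or.inl rfl
  · rw [D.vert_mate_e] at hx; cases hx; exact Or.inr rfl

theorem mem_input_or_output {a : D.pole.E} (ha : D.pole.vert a = none) :
    a ∈ D.input ∨ a ∈ D.output := by
  obtain ⟨x, hx⟩ := Option.ne_none_iff_exists'.1 (D.cubic.1 a.1)
  rcases delete_vert_eq_none ha hx with rfl | rfl
  · exact Or.inl hx
  · exact Or.inr hx

theorem ends_u_inter : D.G.ends D.u ∩ {D.e, D.G.mate D.e} = {D.e} := by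
  ext a
  constructor
  · rintro ⟨h, rfl | rfl⟩
    · rfl
    · exact absurd (Option.some_inj.1 (h.symm.trans D.vert_mate_e)) D.u_ne_v
  · rintro rfl
    exact ⟨D.vert_e, Or.inl rfl⟩

theorem ends_v_inter : D.G.ends D.v ∩ {D.e, D.G.mate D.e} = {D.G.mate D.e} := by
  ext a
  constructor
  · rintro ⟨h, rfl | rfl⟩
    · exact absurd (Option.some_inj.1 (D.vert_e.symm.trans h)) D.u_ne_v
    · rfl
  · rintro rfl
    exact ⟨D.vert_mate_e, Or.inr rfl⟩

theorem ncard_input : D.input.ncard = 2 := by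
  have h : D.input.ncard + _ = _ := ncard_preimage_add (D.G.ends D.u)
  change _ + (D.G.ends D.u ∩ {D.e, D.G.mate D.e}).ncard = _ at h
  rw [ends_u_inter, Set.ncard_singleton, D.cubic.ncard_ends] at h
  omega

theorem ncard_output : D.output.ncard = 2 := by
  have h : D.output.ncard + _ = _ := ncard_preimage_add (D.G.ends D.v)
  change _ + (D.G.ends D.v ∩ {D.e, D.G.mate D.e}).ncard = _ at h
  rw [ends_v_inter, Set.ncard_singleton, D.cubic.ncard_ends] at h
  omega

variable {D}

-- A handshake argument modulo 2: with weight 1 everywhere, only `u` and `v` can contribute, since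
-- every other vertex meets the matching once.
open Classical in
theorem even_input_add_output {F : Set D.pole.E} (hF : D.pole.IsPerfectMatching F) :
    Even ((D.input ∩ F).ncard + (D.output ∩ F).ncard) := by
  have : Fintype D.G.V := Fintype.ofFinite _
  have h := sum_weight_eq_zero D.cubic (fun _ => (1 : ZMod 2)) (by decide)
    (fun _ _ _ _ _ => by decide) _ hF.mate_mem_image
  rw [← Finset.sum_subset (Finset.subset_univ {D.u, D.v}), Finset.sum_pair D.u_ne_v] at h
  · have hu : (D.input ∩ F).ncard = (D.G.ends D.u ∩ deleteEnd '' F).ncard :=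
      ncard_preimage_inter (D.G.ends D.u) F
    have hv : (D.output ∩ F).ncard = (D.G.ends D.v ∩ deleteEnd '' F).ncard :=
      ncard_preimage_inter (D.G.ends D.v) F
    rw [← hu, ← hv, ← add_smul, zsmul_one, ZMod.intCast_zmod_eq_zero_iff_dvd] at h
    rw [even_iff_two_dvd]
    push_cast at h
    omega
  · intro x _ hx
    rw [hF.ncard_ends_inter_image]
    · simp
    · simpa using hx

/-- If both connectors miss exactly the label `z`, adding the edge `uv` to the matchings in `z`
makes all four perfect in `G`. They cover `G` because `z` is nonempty, contradicting the index of
`G`. -/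
theorem not_collinear {F : Fin 4 → Set D.pole.E} (hF : D.pole.IsMatchingFamily F)
    (hcov : ∀ e, ∃ i, e ∈ F i) (heq : setCode F D.input = setCode F D.output) {z : ℕ}
    (hz : z ∈ labelCodes) : setCode F D.input + z ≠ 585 := by
  intro hsum
  obtain ⟨Z, ⟨j, hj⟩, hZ⟩ := exists_subset_of_mem_labelCodes z hz
  have hbound : ∀ {A : Set D.pole.E}, A.ncard = 2 → ∀ i, (A ∩ F i).ncard ≤ 2 := fun hA i =>
    hA ▸ Set.ncard_le_ncard Set.inter_subset_left (Set.toFinite _)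
  have hZ1 : ∀ i, (Z i).toNat ≤ 1 := fun i => Bool.toNat_le _
  have hdigit : ∀ A : Set D.pole.E, A.ncard = 2 → setCode F A + z = 585 →
      ∀ i, (A ∩ F i).ncard + (Z i).toNat = 1 := by
    intro A hA h
    have b := hbound hA
    rw [setCode_eq, hZ] at h
    have b0 := b 0; have b1 := b 1; have b2 := b 2; have b3 := b 3
    have c0 := hZ1 0; have c1 := hZ1 1; have c2 := hZ1 2; have c3 := hZ1 3
    -- Each digit of the sum is at most 3, so there are no carries and the digits can be compared
    -- with those of 585.
    have : (A ∩ F 0).ncard + (Z 0).toNat = 1 ∧ (A ∩ F 1).ncard + (Z 1).toNat = 1 ∧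
        (A ∩ F 2).ncard + (Z 2).toNat = 1 ∧ (A ∩ F 3).ncard + (Z 3).toNat = 1 := by omega
    intro i
    fin_cases i
    exacts [this.1, this.2.1, this.2.2.1, this.2.2.2]
  have hu := hdigit _ D.ncard_input hsum
  have hv := hdigit _ D.ncard_output (heq ▸ hsum)
  let P : Set D.G.E := {D.e, D.G.mate D.e}
  let F' : Fin 4 → Set D.G.E := fun i => deleteEnd '' F i ∪ {a | a ∈ P ∧ Z i = true}
  have hsplit : ∀ x i, (D.G.ends x ∩ F' i).ncard = (D.G.ends x ∩ deleteEnd '' F i).ncard +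
      (D.G.ends x ∩ {a | a ∈ P ∧ Z i = true}).ncard := by
    intro x i
    rw [Set.inter_union_distrib_left]
    refine Set.ncard_union_eq ?_ (Set.toFinite _) (Set.toFinite _)
    rw [Set.disjoint_left]
    rintro _ ⟨-, a, -, rfl⟩ ⟨-, h, -⟩
    exact a.2 h
  have hone : ∀ x a i, D.G.ends x ∩ P = {a} →
      (D.G.ends x ∩ {a | a ∈ P ∧ Z i = true}).ncard = (Z i).toNat := by
    intro x a i h
    cases hi : Z i
    · simp
    · simpa using congrArg Set.ncard h
  refine not_coveredBy_four D.index ⟨F', fun i => isPerfectMatching_of_ncard ?_ fun x => ?_, ?_⟩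
  · rintro e (he | ⟨rfl | rfl, hi⟩)
    · exact Or.inl ((hF i).mate_mem_image e he)
    · exact Or.inr ⟨Or.inr rfl, hi⟩
    · exact Or.inr ⟨Or.inl (D.G.mate_mate _), hi⟩
  · rw [hsplit]
    by_cases hxu : x = D.u
    · subst hxu
      rw [hone _ _ i D.ends_u_inter, ← hu i]
      congr 1
      exact (ncard_preimage_inter (D.G.ends D.u) (F i)).symm
    by_cases hxv : x = D.v
    · subst hxv
      rw [hone _ _ i D.ends_v_inter, ← hv i]
      congr 1
      exact (ncard_preimage_inter (D.G.ends D.v) (F i)).symm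
    rw [(hF i).ncard_ends_inter_image (by rintro (h | h) <;> contradiction)]
    have : D.G.ends x ∩ {a | a ∈ P ∧ Z i = true} = ∅ := by
      rw [← Set.disjoint_iff_inter_eq_empty, Set.disjoint_left]
      rintro a ha ⟨rfl | rfl, -⟩
      · exact hxu (Option.some_inj.1 (ha.symm.trans D.vert_e))
      · exact hxv (Option.some_inj.1 (ha.symm.trans D.vert_mate_e))
    rw [this, Set.ncard_empty]
  · intro e
    by_cases he : e ∈ P
    · exact ⟨j, Or.inr ⟨he, hj⟩⟩
    · obtain ⟨i, hi⟩ := hcov ⟨e, he⟩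
      exact ⟨i, Or.inl ⟨_, hi, rfl⟩⟩

theorem isDecollinear {F : Fin 4 → Set D.pole.E} (hF : D.pole.IsMatchingFamily F)
    (hcov : ∀ e, ∃ i, e ∈ F i) : IsDecollinear (setCode F D.input) (setCode F D.output) := by
  refine ⟨?_, fun ⟨heq, z, hz, h⟩ => not_collinear hF hcov heq hz h⟩
  have key : ∀ i, ∃ k : Fin 3, (D.input ∩ F i).ncard + (D.output ∩ F i).ncard = k + k := by
    intro i
    obtain ⟨k, hk⟩ := even_input_add_output (hF i)
    have h1 : (D.input ∩ F i).ncard ≤ 2 :=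
      D.ncard_input ▸ Set.ncard_le_ncard Set.inter_subset_left (Set.toFinite _)
    have h2 : (D.output ∩ F i).ncard ≤ 2 :=
      D.ncard_output ▸ Set.ncard_le_ncard Set.inter_subset_left (Set.toFinite _)
    exact ⟨⟨k, by omega⟩, hk⟩
  choose k hk using key
  convert isEvenCode_of_even (k 0) (k 1) (k 2) (k 3) using 1
  rw [← hk, ← hk, ← hk, ← hk, setCode_eq, setCode_eq]
  ring

end Decollineator

/-! ### Bipartite poles: the counting identity -/

namespace BipartitePole

variable (B : BipartitePole.{u})

/-- The edges of the path `uwv`. -/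
def path : Set B.G.E := {B.e, B.G.mate B.e} ∪ {B.f, B.G.mate B.f}

theorem mem_path {a : B.G.E} :
    a ∈ B.path ↔ (a = B.e ∨ a = B.G.mate B.e) ∨ (a = B.f ∨ a = B.G.mate B.f) := Iff.rfl

theorem ncard_ends (x : B.pole.V) : (B.pole.ends x).ncard = 3 := by
  refine delete_ncard_ends (fun x _ => B.cubic.ncard_ends x) ?_ x
  rintro e ((rfl | rfl) | (rfl | rfl)) x hx
  · rw [B.vert_e] at hx; cases hx; exact Or.inl rfl
  · rw [B.vert_mate_e] at hx; cases hx; exact Or.inr (Or.inl rfl)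
  · rw [B.vert_f] at hx; cases hx; exact Or.inr (Or.inl rfl)
  · rw [B.vert_mate_f] at hx; cases hx; exact Or.inr (Or.inr rfl)

theorem mem_connector {a : B.pole.E} (ha : B.pole.vert a = none) :
    a ∈ B.input ∨ a ∈ B.residual ∨ a ∈ B.output := by
  obtain ⟨x, hx⟩ := Option.ne_none_iff_exists'.1 (B.cubic.1 a.1)
  rcases delete_vert_eq_none ha hx with rfl | rfl | rfl
  · exact Or.inl hx
  · exact Or.inr (Or.inl hx)
  · exact Or.inr (Or.inr hx)

/-- The edge of a semiedge in the input or output connector has its other end at a vertex or in the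
residual semiedge. -/
theorem mate_mem_residual {a : B.pole.E} (ha : a ∈ B.input ∨ a ∈ B.output)
    (h : B.pole.vert (B.pole.mate a) = none) : B.pole.mate a ∈ B.residual := by
  obtain ⟨c, hc⟩ := B.bipartite
  have huw : c B.u ≠ c B.w := hc _ _ _ B.vert_e B.vert_mate_e
  have hwv : c B.w ≠ c B.v := hc _ _ _ B.vert_f B.vert_mate_f
  have huv : c B.u = c B.v := by
    revert huw hwv
    cases c B.u <;> cases c B.w <;> cases c B.v <;> simp
  have hmate : ∀ y, B.G.vert (B.pole.mate a).1 = some y → c B.u ≠ c y := by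
    intro y hy
    rcases ha with ha | ha
    · exact hc _ _ _ ha hy
    · rw [huv]; exact hc _ _ _ ha hy
  rcases B.mem_connector h with h' | h' | h'
  · exact absurd rfl (hmate _ h')
  · exact h'
  · exact absurd huv (hmate _ h')

theorem ends_u_inter : B.G.ends B.u ∩ B.path = {B.e} := by
  ext a
  rw [Set.mem_inter_iff, mem_path, Set.mem_singleton_iff]
  constructor
  · rintro ⟨h, (rfl | rfl) | (rfl | rfl)⟩
    · rfl
    · exact absurd (Option.some_inj.1 (h.symm.trans B.vert_mate_e)) B.u_ne_w
    · exact absurd (Option.some_inj.1 (h.symm.trans B.vert_f)) B.u_ne_w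
    · exact absurd (Option.some_inj.1 (h.symm.trans B.vert_mate_f)) B.u_ne_v
  · rintro rfl
    exact ⟨B.vert_e, Or.inl (Or.inl rfl)⟩

theorem ends_v_inter : B.G.ends B.v ∩ B.path = {B.G.mate B.f} := by
  ext a
  rw [Set.mem_inter_iff, mem_path, Set.mem_singleton_iff]
  constructor
  · rintro ⟨h, (rfl | rfl) | (rfl | rfl)⟩
    · exact absurd (Option.some_inj.1 (B.vert_e.symm.trans h)) B.u_ne_v
    · exact absurd (Option.some_inj.1 (B.vert_mate_e.symm.trans h)) B.w_ne_v
    · exact absurd (Option.some_inj.1 (B.vert_f.symm.trans h)) B.w_ne_v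
    · rfl
  · rintro rfl
    exact ⟨B.vert_mate_f, Or.inr (Or.inr rfl)⟩

theorem ends_w_inter : B.G.ends B.w ∩ B.path = {B.G.mate B.e, B.f} := by
  ext a
  rw [Set.mem_inter_iff, mem_path]
  constructor
  · rintro ⟨h, (rfl | rfl) | (rfl | rfl)⟩
    · exact absurd (Option.some_inj.1 (B.vert_e.symm.trans h)) B.u_ne_w
    · exact Or.inl rfl
    · exact Or.inr rfl
    · exact absurd (Option.some_inj.1 (h.symm.trans B.vert_mate_f)) B.w_ne_v
  · rintro (rfl | rfl)
    · exact ⟨B.vert_mate_e, Or.inl (Or.inr rfl)⟩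
    · exact ⟨B.vert_f, Or.inr (Or.inl rfl)⟩

theorem mate_e_ne_f : B.G.mate B.e ≠ B.f := by
  intro h
  have := B.vert_mate_f
  rw [← h, B.G.mate_mate, B.vert_e] at this
  exact B.u_ne_v (Option.some_inj.1 this)

theorem ncard_input : B.input.ncard = 2 := by
  have h : B.input.ncard + _ = _ := ncard_preimage_add (B.G.ends B.u)
  change _ + (B.G.ends B.u ∩ B.path).ncard = _ at h
  rw [ends_u_inter, Set.ncard_singleton, B.cubic.ncard_ends] at h
  omega

theorem ncard_output : B.output.ncard = 2 := by
  have h : B.output.ncard + _ = _ := ncard_preimage_add (B.G.ends B.v)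
  change _ + (B.G.ends B.v ∩ B.path).ncard = _ at h
  rw [ends_v_inter, Set.ncard_singleton, B.cubic.ncard_ends] at h
  omega

theorem ncard_residual : B.residual.ncard = 1 := by
  have h : B.residual.ncard + _ = _ := ncard_preimage_add (B.G.ends B.w)
  change _ + (B.G.ends B.w ∩ B.path).ncard = _ at h
  rw [ends_w_inter, Set.ncard_pair B.mate_e_ne_f, B.cubic.ncard_ends] at h
  omega

variable {B}

-- With weights 1 and -1 on the two colour classes only `u`, `w`, `v` contribute. As `u` and `v`
-- have the colour opposite to `w`, their excesses add up to the excess at `w`.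
open Classical in
theorem ncard_input_add_ncard_output {F : Set B.pole.E} (hF : B.pole.IsPerfectMatching F) :
    (B.input ∩ F).ncard + (B.output ∩ F).ncard = 1 + (B.residual ∩ F).ncard := by
  have : Fintype B.G.V := Fintype.ofFinite _
  obtain ⟨c, hc⟩ := B.bipartite
  have huw : c B.u ≠ c B.w := hc _ _ _ B.vert_e B.vert_mate_e
  have hwv : c B.w ≠ c B.v := hc _ _ _ B.vert_f B.vert_mate_f
  have h := sum_weight_eq_zero B.cubic (fun x => if c x then (1 : ℤ) else -1)
    (fun a h => by simpa using h)
    (fun e x y hx hy => by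
      have := hc e x y hx hy
      revert this
      cases c x <;> cases c y <;> simp) _ hF.mate_mem_image
  rw [← Finset.sum_subset (Finset.subset_univ {B.u, B.w, B.v}), Finset.sum_insert,
    Finset.sum_pair B.w_ne_v] at h
  · have hu : (B.input ∩ F).ncard = (B.G.ends B.u ∩ deleteEnd '' F).ncard :=
      ncard_preimage_inter (B.G.ends B.u) F
    have hv : (B.output ∩ F).ncard = (B.G.ends B.v ∩ deleteEnd '' F).ncard :=
      ncard_preimage_inter (B.G.ends B.v) F
    have hw : (B.residual ∩ F).ncard = (B.G.ends B.w ∩ deleteEnd '' F).ncard :=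
      ncard_preimage_inter (B.G.ends B.w) F
    rw [← hu, ← hv, ← hw] at h
    revert h huw hwv
    cases c B.u <;> cases c B.w <;> cases c B.v <;> simp <;> omega
  · simp [B.u_ne_w, B.u_ne_v]
  · intro x _ hx
    rw [hF.ncard_ends_inter_image]
    · simp
    · simpa using hx

theorem setCode_input_add_setCode_output {F : Fin 4 → Set B.pole.E}
    (hF : B.pole.IsMatchingFamily F) :
    setCode F B.input + setCode F B.output = 585 + setCode F B.residual := by
  have h0 := ncard_input_add_ncard_output (hF 0)
  have h1 := ncard_input_add_ncard_output (hF 1)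
  have h2 := ncard_input_add_ncard_output (hF 2)
  have h3 := ncard_input_add_ncard_output (hF 3)
  simp only [setCode_eq]
  omega

end BipartitePole

/-! ### Plane trees and their boundary walks -/

/-- Both candidates are the last vertex before `w` on the unique path from `u` to `w`. -/
theorem SimpleGraph.IsTree.eq_of_dist_lt {V : Type*} {G : SimpleGraph V} (hG : G.IsTree)
    {u x y w : V} (hx : G.Adj x w) (hy : G.Adj y w) (hdx : G.dist u w = G.dist u x + 1)
    (hdy : G.dist u w = G.dist u y + 1) : x = y := by
  have key : ∀ z, G.Adj z w → G.dist u w = G.dist u z + 1 →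
      ∃ p : G.Walk u w, p.IsPath ∧ p.penultimate = z := by
    intro z hz hd
    obtain ⟨p, hp, hl⟩ := (hG.connected u z).exists_path_of_dist
    refine ⟨p.concat hz, SimpleGraph.Walk.isPath_of_length_eq_dist _ ?_, p.penultimate_concat hz⟩
    rw [SimpleGraph.Walk.length_concat, hl, hd]
  obtain ⟨p, hp, rfl⟩ := key x hx hdx
  obtain ⟨q, hq, rfl⟩ := key y hy hdy
  rw [(hG.existsUnique_path u w).unique hp hq]

namespace PlaneCubicTree

variable (T : PlaneCubicTree.{u})

instance : Finite T.S.Dart :=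
  Finite.of_injective (fun d : T.S.Dart => d.toProd) SimpleGraph.Dart.toProd_injective

theorem ncard_darts (x : T.V) : {d : T.S.Dart | d.fst = x}.ncard = (T.S.neighborSet x).ncard := by
  have : T.S.neighborSet x = (fun d : T.S.Dart => d.snd) '' {d | d.fst = x} := by
    ext y
    constructor
    · intro h
      exact ⟨⟨(x, y), h⟩, rfl, rfl⟩
    · rintro ⟨d, rfl, rfl⟩
      exact d.adj
  rw [this, Set.InjOn.ncard_image]
  intro d hd d' hd' h
  exact SimpleGraph.Dart.ext _ _ (Prod.ext (hd.trans hd'.symm) h)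

theorem rot_fst (d : T.S.Dart) : (T.rot d).fst = d.fst :=
  ((T.rot_sameCycle d (T.rot d)).1 ⟨1, by simp⟩).symm

theorem rot_isCycleOn (x : T.V) : T.rot.IsCycleOn {d : T.S.Dart | d.fst = x} := by
  refine ⟨?_, fun d hd d' hd' => (T.rot_sameCycle d d').2 (hd.trans hd'.symm)⟩
  refine ⟨fun d hd => (T.rot_fst d).trans hd, T.rot.injective.injOn, fun d hd => ?_⟩
  refine ⟨T.rot.symm d, ?_, by simp⟩
  have := T.rot_fst (T.rot.symm d)
  rw [Equiv.apply_symm_apply] at this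
  exact this.symm.trans hd

theorem rot_pow_apply_eq (d : T.S.Dart) (n : ℕ) :
    (T.rot ^ n) d = d ↔ (T.S.neighborSet d.fst).ncard ∣ n := by
  have : Fintype {d' : T.S.Dart | d'.fst = d.fst} := Fintype.ofFinite _
  rw [← ncard_darts, Set.ncard_eq_toFinset_card', ← Equiv.Perm.IsCycleOn.pow_apply_eq]
  · simpa using T.rot_isCycleOn d.fst
  · simp

variable {T}

theorem eq_of_isLeaf {d d' : T.S.Dart} (h : T.IsLeaf d.fst) (hd : d'.fst = d.fst) : d' = d := by
  obtain ⟨a, ha⟩ := Set.ncard_eq_one.1 ((T.ncard_darts d.fst).trans h)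
  have h1 : d ∈ {d' : T.S.Dart | d'.fst = d.fst} := rfl
  have h2 : d' ∈ {d' : T.S.Dart | d'.fst = d.fst} := hd
  rw [ha] at h1 h2
  exact h2.trans h1.symm

theorem ncard_neighborSet {x : T.V} (h : ¬ T.IsLeaf x) : (T.S.neighborSet x).ncard = 3 :=
  (T.valency x).resolve_left h

theorem rot_ne {d : T.S.Dart} (h : ¬ T.IsLeaf d.fst) : T.rot d ≠ d := by
  have := (T.rot_pow_apply_eq d 1).not
  rw [ncard_neighborSet h] at this
  simpa using this

theorem rot_rot_ne {d : T.S.Dart} (h : ¬ T.IsLeaf d.fst) : T.rot (T.rot d) ≠ d := by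
  have := (T.rot_pow_apply_eq d 2).not
  rw [ncard_neighborSet h] at this
  simpa [pow_two] using this

theorem rot_rot_rot {d : T.S.Dart} (h : ¬ T.IsLeaf d.fst) : T.rot (T.rot (T.rot d)) = d := by
  have := T.rot_pow_apply_eq d 3
  rw [ncard_neighborSet h] at this
  simpa [pow_succ] using this

theorem darts_eq {d : T.S.Dart} (h : ¬ T.IsLeaf d.fst) :
    {d' : T.S.Dart | d'.fst = d.fst} = {d, T.rot d, T.rot (T.rot d)} := by
  symm
  refine Set.eq_of_subset_of_ncard_le ?_ ?_
  · rintro _ (rfl | rfl | rfl)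
    · rfl
    · exact T.rot_fst d
    · exact (T.rot_fst _).trans (T.rot_fst d)
  · rw [ncard_darts, ncard_neighborSet h,
      Set.ncard_eq_three.2 ⟨_, _, _, (rot_ne h).symm, (rot_rot_ne h).symm, ?_, rfl⟩]
    exact fun h' => rot_ne h (T.rot.injective h').symm

/-- `y` is the first leaf at which the boundary walk along the dart `d` arrives. -/
def IsFirstLeaf (T : PlaneCubicTree.{u}) (d : T.S.Dart) (y : T.Leaf) : Prop :=
  ∃ n : ℕ, (T.step^[n] d).snd = y.1 ∧ ∀ m < n, ¬ T.IsLeaf (T.step^[m] d).snd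

theorem IsFirstLeaf.unique {d : T.S.Dart} {y y' : T.Leaf} (h : T.IsFirstLeaf d y)
    (h' : T.IsFirstLeaf d y') : y = y' := by
  obtain ⟨n, hn, hlt⟩ := h
  obtain ⟨n', hn', hlt'⟩ := h'
  rcases lt_trichotomy n n' with h | rfl | h
  · exact absurd (hn ▸ y.2) (hlt' n h)
  · exact Subtype.ext (hn.symm.trans hn')
  · exact absurd (hn' ▸ y'.2) (hlt n' h)

/-- Darts bounding the same sector between consecutive leaves thus determine the same leaf, which is
how sectors are compared around an inner vertex. -/
theorem isFirstLeaf_step {d : T.S.Dart} (hd : ¬ T.IsLeaf d.snd) {y : T.Leaf} :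
    T.IsFirstLeaf (T.step d) y ↔ T.IsFirstLeaf d y := by
  constructor
  · rintro ⟨n, hn, hlt⟩
    refine ⟨n + 1, hn, fun m hm => ?_⟩
    rcases m with _ | m
    · exact hd
    · exact hlt m (by omega)
  · rintro ⟨_ | n, hn, hlt⟩
    · exact absurd (hn ▸ y.2) hd
    · exact ⟨n, hn, fun m hm => hlt (m + 1) (by omega)⟩

theorem isFirstLeaf_self {d : T.S.Dart} (hd : T.IsLeaf d.snd) : T.IsFirstLeaf d ⟨d.snd, hd⟩ :=
  ⟨0, rfl, fun _ h => absurd h (Nat.not_lt_zero _)⟩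

theorem IsNextLeaf.isFirstLeaf {d : T.S.Dart} (hd : T.IsLeaf d.snd) {y : T.Leaf}
    (h : T.IsNextLeaf ⟨d.snd, hd⟩ y) : T.IsFirstLeaf d.symm y := by
  obtain ⟨d', hd', n, hn⟩ := h
  rw [eq_of_isLeaf (d := d.symm) (d' := d') hd hd'] at hn
  exact ⟨n, hn⟩

/-- There is no assignment of codes to the sectors and of labels to the edges of a plane cubic tree
such that all changes at leaves are transitions. -/
theorem not_forall_isTransition {next : T.Leaf → T.Leaf} (hnext : ∀ x, T.IsNextLeaf x (next x))
    {r : T.S.Dart → ℕ} (hr : ∀ d, r d ∈ labelCodes) (hsymm : ∀ d, r d.symm = r d)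
    (hsum : ∀ d, ¬ T.IsLeaf d.fst → r d + r (T.rot d) + r (T.rot (T.rot d)) = 585)
    {N : T.Leaf → ℕ} (hN : ∀ x, N x ∈ connectorCodes) :
    ¬ ∀ (d : T.S.Dart) (hd : T.IsLeaf d.snd),
      IsTransition (r d) (N ⟨d.snd, hd⟩) (N (next ⟨d.snd, hd⟩)) := by
  intro htrans
  obtain ⟨u, hu⟩ := T.exists_trivalent
  have huleaf : ¬ T.IsLeaf u := by
    intro h
    rw [IsLeaf, hu] at h
    omega
  -- Returning to an inner vertex along `d`, the boundary walk leaves along `T.rot d`: neighbouring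
  -- branches share the sector between them.
  have hrot : ∀ {d : T.S.Dart} {y z : T.Leaf}, ¬ T.IsLeaf d.fst → T.IsFirstLeaf d.symm y →
      T.IsFirstLeaf (T.rot d) z → y = z := by
    intro d y z hd hy hz
    rw [← isFirstLeaf_step (by exact hd)] at hy
    exact IsFirstLeaf.unique hy (by rwa [step, SimpleGraph.Dart.symm_symm])
  have hbound : ∃ n, ∀ x, T.S.dist u x ≤ n := by
    have : Fintype T.V := Fintype.ofFinite _
    exact ⟨Finset.univ.sup (T.S.dist u), fun x => Finset.le_sup (Finset.mem_univ x)⟩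
  obtain ⟨n, hn⟩ := hbound
  -- The darts considered point away from the root `u`. As `n` bounds all distances from `u`,
  -- increasing `k` amounts to induction from the far ends of the tree towards the root.
  have key : ∀ k (d : T.S.Dart), T.S.dist u d.snd = T.S.dist u d.fst + 1 →
      n < T.S.dist u d.snd + k →
      ∃ x y, T.IsFirstLeaf d x ∧ T.IsFirstLeaf d.symm y ∧ IsTransition (r d) (N x) (N y) := by
    intro k
    induction k with
    | zero => intro d _ h; exact absurd (hn d.snd) (by omega)
    | succ k ih =>
      intro d hd hk
      by_cases hleaf : T.IsLeaf d.snd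
      · exact ⟨_, _, isFirstLeaf_self hleaf, (hnext _).isFirstLeaf hleaf, htrans d hleaf⟩
      have h0 : ¬ T.IsLeaf d.symm.fst := hleaf
      have haway : ∀ d' : T.S.Dart, d'.fst = d.snd → d' ≠ d.symm →
          ∃ x y, T.IsFirstLeaf d' x ∧ T.IsFirstLeaf d'.symm y ∧
            IsTransition (r d') (N x) (N y) := by
        intro d' hd' hne
        have hdist : T.S.dist u d'.snd = T.S.dist u d'.fst + 1 := by
          refine (T.isTree.dist_eq_dist_add_one_of_adj u d'.adj).resolve_left fun h => ?_
          rw [hd'] at h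
          have hadj := d'.adj.symm
          rw [hd'] at hadj
          -- A second dart towards the root would have to be `d.symm`.
          have := T.isTree.eq_of_dist_lt d.adj hadj hd h
          exact hne (SimpleGraph.Dart.ext _ _ (Prod.ext hd' this.symm))
        refine ih d' hdist ?_
        rw [hdist, hd']
        omega
      have h1 : (T.rot d.symm).fst = d.snd := T.rot_fst _
      have h2 : (T.rot (T.rot d.symm)).fst = d.snd := (T.rot_fst _).trans h1
      obtain ⟨x₁, y₁, hx₁, hy₁, ht₁⟩ := haway (T.rot d.symm) h1 (rot_ne h0)
      obtain ⟨x₂, y₂, hx₂, hy₂, ht₂⟩ := haway (T.rot (T.rot d.symm)) h2 (rot_rot_ne h0)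
      -- The end of the first branch is the start of the second, so their transitions can be
      -- composed.
      obtain rfl := hrot (h1 ▸ hleaf) hy₁ hx₂
      refine ⟨x₁, y₂, (isFirstLeaf_step hleaf).1 hx₁, ?_, ?_⟩
      · have h3 : ¬ T.IsLeaf (T.rot (T.rot d.symm)).symm.snd := by
          change ¬ T.IsLeaf (T.rot (T.rot d.symm)).fst
          rwa [h2]
        have := (isFirstLeaf_step h3).2 hy₂
        rwa [step, SimpleGraph.Dart.symm_symm, rot_rot_rot h0] at this
      · refine (IsTransition.trans (hr _) (hr _) (hr d) ?_ (hN _) (hN _) (hN _) ht₁ ht₂).1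
        rw [← hsum _ h0, hsymm]
        ring
  have hroot : ∀ d : T.S.Dart, d.fst = u →
      ∃ x y, T.IsFirstLeaf d x ∧ T.IsFirstLeaf d.symm y ∧ IsTransition (r d) (N x) (N y) := by
    intro d hd
    refine key (n + 1) d ?_ (by omega)
    refine (T.isTree.dist_eq_dist_add_one_of_adj u d.adj).resolve_left fun h => ?_
    rw [hd, SimpleGraph.dist_self] at h
    omega
  have hne : (T.S.neighborSet u).Nonempty := by
    rw [← Set.ncard_pos]
    omega
  obtain ⟨v, hv⟩ := hne
  have hd : ∃ d : T.S.Dart, d.fst = u := ⟨⟨(u, v), hv⟩, rfl⟩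
  obtain ⟨d, rfl⟩ := hd
  have h1 : (T.rot d).fst = d.fst := T.rot_fst _
  have h2 : (T.rot (T.rot d)).fst = d.fst := (T.rot_fst _).trans h1
  obtain ⟨x₀, y₀, hx₀, hy₀, ht₀⟩ := hroot d rfl
  obtain ⟨x₁, y₁, hx₁, hy₁, ht₁⟩ := hroot _ h1
  obtain ⟨x₂, y₂, hx₂, hy₂, ht₂⟩ := hroot _ h2
  obtain rfl := hrot huleaf hy₀ hx₁
  obtain rfl := hrot (h1 ▸ huleaf) hy₁ hx₂
  -- The third rotation returns to `d`, so the last sector is identified with the first and the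
  -- three transitions form a cycle.
  rw [← rot_rot_rot huleaf] at hx₀
  obtain rfl := hrot (h2 ▸ huleaf) hy₂ hx₀
  exact (IsTransition.trans (hr _) (hr _) (hr _) (hsum d huleaf) (hN _) (hN _) (hN _) ht₀ ht₁).2 ht₂

end PlaneCubicTree

/-! ### Assembling the snark -/

theorem setCode_equiv {α β : Type*} {F : Fin 4 → Set α} {F' : Fin 4 → Set β} {A : Set α} {B : Set β}
    (φ : A ≃ B) (h : ∀ (a : A) (i : Fin 4), a.1 ∈ F i ↔ (φ a).1 ∈ F' i) :
    setCode F A = setCode F' B := by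
  unfold setCode
  refine Finset.sum_congr rfl fun i _ => ?_
  congr 1
  refine Set.ncard_congr (fun a ha => (φ ⟨a, ha.1⟩).1)
    (fun a ha => ⟨(φ ⟨a, ha.1⟩).2, (h ⟨a, ha.1⟩ i).1 ha.2⟩) (fun a b ha hb hab => ?_)
    (fun b hb => ?_)
  · simpa using φ.injective (Subtype.ext hab)
  · refine ⟨(φ.symm ⟨b, hb.1⟩).1, ⟨(φ.symm ⟨b, hb.1⟩).2, ?_⟩, by simp⟩
    rw [h]
    simpa using hb.2

theorem exists_mem_of_setCode_mem {α : Type*} {F : Fin 4 → Set α} {a : α}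
    (h : setCode F {a} ∈ labelCodes) : ∃ i, a ∈ F i := by
  by_contra! hne
  have : setCode F {a} = 0 :=
    Finset.sum_eq_zero fun i _ => by rw [Set.singleton_inter_eq_empty.2 (hne i)]; simp
  rw [this] at h
  revert h
  decide

theorem Multipole.IsPart.vert_eq_some {M N : Multipole.{u}} {f : M.E → N.E} {g : M.V → N.V}
    (h : IsPart M N f g) {e : M.E} {x : M.V} (hx : M.vert e = some x) :
    N.vert (f e) = some (g x) := by
  have : f e ∈ N.ends (g x) := by
    rw [h.ends_eq]
    exact ⟨e, hx, rfl⟩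
  exact this

theorem Multipole.IsPerfectMatching.mate_mem_iff {M : Multipole.{u}} {F : Set M.E}
    (h : M.IsPerfectMatching F) (e : M.E) : M.mate e ∈ F ↔ e ∈ F :=
  ⟨fun he => M.mate_mate e ▸ h.1 _ he, h.1 e⟩

namespace PlaneCubicTree

variable {T : PlaneCubicTree.{u}}

/-- Two adjacent leaves would form a whole component, leaving no room for the trivalent vertex in a
connected tree. -/
theorem not_isLeaf_snd {d : T.S.Dart} (hd : T.IsLeaf d.fst) : ¬ T.IsLeaf d.snd := by
  intro hd'
  have key : ∀ {a b : T.V} (p : T.S.Walk a b), (a = d.fst ∨ a = d.snd) → b = d.fst ∨ b = d.snd := by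
    intro a b p
    induction p with
    | nil => exact id
    | @cons a c b hac p ih =>
      rintro (rfl | rfl)
      · have h := eq_of_isLeaf (d := d) (d' := ⟨(d.fst, c), hac⟩) hd rfl
        exact ih (Or.inr (congrArg (fun d : T.S.Dart => d.snd) h))
      · have h := eq_of_isLeaf (d := d.symm) (d' := ⟨(d.snd, c), hac⟩) hd' rfl
        exact ih (Or.inl (congrArg (fun d : T.S.Dart => d.snd) h))
  obtain ⟨u, hu⟩ := T.exists_trivalent
  obtain ⟨p⟩ := T.isTree.connected d.fst u
  have : T.IsLeaf u := by
    rcases key p (Or.inl rfl) with rfl | rfl <;> assumption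
  rw [IsLeaf, hu] at this
  omega

theorem exists_dart (x : T.V) : ∃ d : T.S.Dart, d.fst = x := by
  have h : {d : T.S.Dart | d.fst = x}.Nonempty := by
    rw [← Set.ncard_pos, ncard_darts]
    rcases T.valency x with h | h <;> omega
  exact h

end PlaneCubicTree

namespace HalinSnarkData

variable (X : HalinSnarkData.{u})

theorem isPart_D (x : X.H.Leaf) :
    IsPart (X.D x).pole X.parts (X.inD x) (fun v => Sum.inl ⟨x, v⟩) :=
  (isPart_sigma (fun x => (X.D x).pole) x).trans (isPart_sum_left _ _)

theorem isPart_B (x : X.H.Leaf) :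
    IsPart (X.B x).pole X.parts (X.inB x) (fun v => Sum.inr (Sum.inl ⟨x, v⟩)) :=
  ((isPart_sigma (fun x => (X.B x).pole) x).trans (isPart_sum_left _ _)).trans
    (isPart_sum_right _ _)

theorem isPart_inner :
    IsPart X.H.inner X.parts (fun e => Sum.inr (Sum.inr e)) (fun v => Sum.inr (Sum.inr v)) :=
  (isPart_sum_right _ _).trans (isPart_sum_right _ _)

theorem inS_injective : Function.Injective X.inS := fun _ _ h =>
  congrArg Subtype.val (Sum.inr_injective (Sum.inr_injective h))

theorem mate_inS (d : X.H.S.Dart) : X.parts.mate (X.inS d) = X.inS d.symm := rfl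

/-- An inner vertex of the tree. -/
def inV (x : X.H.V) (hx : ¬ X.H.IsLeaf x) : X.parts.V := Sum.inr (Sum.inr ⟨x, hx⟩)

theorem ends_inV (x : X.H.V) (hx : ¬ X.H.IsLeaf x) :
    X.parts.ends (X.inV x hx) = X.inS '' {d | d.fst = x} := by
  refine (X.isPart_inner.ends_eq _).trans ?_
  have h : X.H.inner.ends (deleteVertex (M := ofSimpleGraph X.H.S) (R := {x | X.H.IsLeaf x}) x hx) =
      deleteEnd ⁻¹' (ofSimpleGraph X.H.S).ends x := delete_ends (M := ofSimpleGraph X.H.S) x hx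
  refine (congrArg _ h).trans ?_
  ext e
  constructor
  · rintro ⟨a, ha, rfl⟩
    exact ⟨a.1, Option.some_inj.1 ha, rfl⟩
  · rintro ⟨d, hd, rfl⟩
    exact ⟨⟨d, fun h => h⟩, Option.some_inj.2 hd, rfl⟩

theorem ncard_ends_inV (x : X.H.V) (hx : ¬ X.H.IsLeaf x) :
    (X.parts.ends (X.inV x hx)).ncard = 3 := by
  rw [ends_inV, Set.ncard_image_of_injective _ X.inS_injective, PlaneCubicTree.ncard_darts]
  exact PlaneCubicTree.ncard_neighborSet hx

theorem ncard_ends (v : X.parts.V) : (X.parts.ends v).ncard = 3 := by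
  rcases v with ⟨x, v⟩ | ⟨x, v⟩ | ⟨v, hv⟩
  · rw [(X.isPart_D x).ends_eq, Set.ncard_image_of_injective _ (X.isPart_D x).injective]
    exact (X.D x).ncard_ends v
  · rw [(X.isPart_B x).ends_eq, Set.ncard_image_of_injective _ (X.isPart_B x).injective]
    exact (X.B x).ncard_ends v
  · exact X.ncard_ends_inV v hv

variable {X}

variable (X) in
/-- Four perfect matchings of the parts that respect the junctions and cover all edge ends at the
vertices. -/
structure IsWeldedFamily (F : Fin 4 → Set X.parts.E) : Prop where
  family : X.parts.IsMatchingFamily F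
  weld : ∀ s t, X.Weld s t → ∀ i, s ∈ F i ↔ t ∈ F i
  cover : ∀ e, X.parts.vert e ≠ none → ∃ i, e ∈ F i

namespace IsWeldedFamily

variable {F : Fin 4 → Set X.parts.E}
theorem label_mate (hF : X.IsWeldedFamily F) (e : X.parts.E) :
    setCode F {X.parts.mate e} = setCode F {e} :=
  setCode_singleton_congr fun i => (hF.family i).mate_mem_iff e

theorem setCode_inS_sum (hF : X.IsWeldedFamily F) {d : X.H.S.Dart} (hd : ¬ X.H.IsLeaf d.fst) :
    setCode F {X.inS d} + setCode F {X.inS (X.H.rot d)} +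
      setCode F {X.inS (X.H.rot (X.H.rot d))} = 585 := by
  have h := hF.family.setCode_ends (X.inV _ hd)
  rwa [ends_inV, PlaneCubicTree.darts_eq hd, Set.image_insert_eq, Set.image_pair,
    setCode_triple] at h
  · exact fun h => PlaneCubicTree.rot_ne hd (X.inS_injective h).symm
  · exact fun h => PlaneCubicTree.rot_rot_ne hd (X.inS_injective h).symm
  · exact fun h => PlaneCubicTree.rot_ne hd (X.H.rot.injective (X.inS_injective h)).symm

theorem label_mem_of_vert (hF : X.IsWeldedFamily F) {e : X.parts.E} {v : X.parts.V}
    (h : X.parts.vert e = some v) :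
    setCode F {e} ∈ labelCodes := by
  refine hF.family.label_mem (X.ncard_ends v) (fun e he => hF.cover e ?_) h
  rw [show X.parts.vert e = some v from he]
  simp

/-- Even the edge at a leaf has an end at an inner vertex, where the covering hypothesis applies. -/
theorem label_inS_mem (hF : X.IsWeldedFamily F) (d : X.H.S.Dart) :
    setCode F {X.inS d} ∈ labelCodes := by
  have key : ∀ d : X.H.S.Dart, ¬ X.H.IsLeaf d.fst → setCode F {X.inS d} ∈ labelCodes := by
    intro d hd
    refine label_mem_of_vert hF (v := X.inV _ hd) ?_
    have : X.inS d ∈ X.parts.ends (X.inV _ hd) := by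
      rw [ends_inV]
      exact ⟨d, rfl, rfl⟩
    exact this
  by_cases hd : X.H.IsLeaf d.fst
  · rw [← label_mate hF, mate_inS]
    exact key _ (PlaneCubicTree.not_isLeaf_snd hd)
  · exact key d hd

theorem label_residual (hF : X.IsWeldedFamily F) {x : X.H.Leaf} {a : (X.B x).pole.E}
    (ha : a ∈ (X.B x).residual)
    {d : X.H.S.Dart} (hd : d.fst = x.1) : setCode F {X.inB x a} = setCode F {X.inS d} :=
  setCode_singleton_congr fun i => hF.weld _ _ (.residual x a ha d hd) i

theorem label_residual_mem (hF : X.IsWeldedFamily F) {x : X.H.Leaf} {a : (X.B x).pole.E}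
    (ha : a ∈ (X.B x).residual) :
    setCode F {X.inB x a} ∈ labelCodes := by
  obtain ⟨d, hd⟩ := PlaneCubicTree.exists_dart x.1
  rw [label_residual hF ha hd]
  exact label_inS_mem hF d

/-- Covering is not assumed at free ends. Bipartiteness ensures that the edge of a connector
semiedge leads to a vertex or to the residual semiedge, whose label is known from the tree. -/
theorem label_inB_mem (hF : X.IsWeldedFamily F) (x : X.H.Leaf) (a : (X.B x).pole.E) :
    setCode F {X.inB x a} ∈ labelCodes := by
  have hv : ∀ b : (X.B x).pole.E, (X.B x).pole.vert b ≠ none →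
      setCode F {X.inB x b} ∈ labelCodes := by
    intro b hb
    obtain ⟨v, hv⟩ := Option.ne_none_iff_exists'.1 hb
    exact label_mem_of_vert hF ((X.isPart_B x).vert_eq_some hv)
  have hio : a ∈ (X.B x).input ∨ a ∈ (X.B x).output → setCode F {X.inB x a} ∈ labelCodes := by
    intro h
    rw [← label_mate hF, (X.isPart_B x).mate]
    by_cases hm : (X.B x).pole.vert ((X.B x).pole.mate a) = none
    · exact label_residual_mem hF ((X.B x).mate_mem_residual h hm)
    · exact hv _ hm
  by_cases ha : (X.B x).pole.vert a = none
  · rcases (X.B x).mem_connector ha with h | h | h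
    · exact hio (Or.inl h)
    · exact label_residual_mem hF h
    · exact hio (Or.inr h)
  · exact hv a ha

/-- An edge of the decollineator may have both ends free (when `uv` has a parallel edge), so free
ends take their labels from the adjacent bipartite poles instead. -/
theorem label_inD_mem (hF : X.IsWeldedFamily F) (x : X.H.Leaf) (a : (X.D x).pole.E) :
    setCode F {X.inD x a} ∈ labelCodes := by
  by_cases ha : (X.D x).pole.vert a = none
  · rcases (X.D x).mem_input_or_output ha with h | h
    · obtain ⟨y, rfl⟩ := X.H.next.surjective x
      have hw := Weld.between y ((X.between y).symm ⟨a, h⟩)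
      rw [Equiv.apply_symm_apply] at hw
      rw [← setCode_singleton_congr (hF.weld _ _ hw)]
      exact label_inB_mem hF y _
    · rw [setCode_singleton_congr (hF.weld _ _ (Weld.inside x ⟨a, h⟩))]
      exact label_inB_mem hF x _
  · obtain ⟨v, hv⟩ := Option.ne_none_iff_exists'.1 ha
    exact label_mem_of_vert hF ((X.isPart_D x).vert_eq_some hv)

end IsWeldedFamily

open IsWeldedFamily in
theorem not_isWeldedFamily (F : Fin 4 → Set X.parts.E) : ¬ X.IsWeldedFamily F := by
  intro hF
  let FD := fun x i => X.inD x ⁻¹' F i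
  let FB := fun x i => X.inB x ⁻¹' F i
  have hFD : ∀ x, (X.D x).pole.IsMatchingFamily (FD x) := fun x i =>
    (X.isPart_D x).isPerfectMatching (hF.family i)
  have hFB : ∀ x, (X.B x).pole.IsMatchingFamily (FB x) := fun x i =>
    (X.isPart_B x).isPerfectMatching (hF.family i)
  have hlabD : ∀ x a, setCode (FD x) {a} = setCode F {X.inD x a} := fun x a =>
    setCode_singleton_congr fun _ => Iff.rfl
  have hlabB : ∀ x a, setCode (FB x) {a} = setCode F {X.inB x a} := fun x a =>
    setCode_singleton_congr fun _ => Iff.rfl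
  have hcodeD : ∀ x (A : Set (X.D x).pole.E), A.ncard = 2 →
      setCode (FD x) A ∈ connectorCodes := fun x A hA =>
    setCode_mem_connectorCodes hA fun a _ => hlabD x a ▸ label_inD_mem hF x a
  have hinside : ∀ x, setCode (FD x) (X.D x).output = setCode (FB x) (X.B x).input := fun x =>
    setCode_equiv (X.inside x) fun a i => hF.weld _ _ (.inside x a) i
  have hbetween : ∀ x, setCode (FB x) (X.B x).output =
      setCode (FD (X.H.next x)) (X.D (X.H.next x)).input := fun x =>
    setCode_equiv (X.between x) fun a i => hF.weld _ _ (.between x a) i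
  have hdec : ∀ x, IsDecollinear (setCode (FD x) (X.D x).input) (setCode (FD x) (X.D x).output) :=
    fun x => Decollineator.isDecollinear (hFD x) fun e =>
      exists_mem_of_setCode_mem (hlabD x e ▸ label_inD_mem hF x e)
  refine PlaneCubicTree.not_forall_isTransition (T := X.H.toPlaneCubicTree) X.H.next_plane
    (r := fun d => setCode F {X.inS d}) (label_inS_mem hF)
    (fun d => label_mate hF (X.inS d)) (fun d hd => setCode_inS_sum hF hd)
    (N := fun x => setCode (FD x) (X.D x).input) (fun x => hcodeD x _ (X.D x).ncard_input) ?_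
  intro d hd
  set x : X.H.Leaf := ⟨d.snd, hd⟩
  obtain ⟨a, ha⟩ := Set.ncard_eq_one.1 (X.B x).ncard_residual
  -- The dart `d` arrives at the leaf, while the residual semiedge is welded to the dart leaving it;
  -- the two have the same label.
  have hres : setCode F {X.inS d} = setCode (FB x) (X.B x).residual := by
    rw [ha, hlabB, label_residual hF (d := d.symm) (ha ▸ rfl) rfl, ← mate_inS,
      label_mate hF]
  -- The required continuation of the next input code is the output code of the next decollineator.
  refine isTransition_of_fragment _ (hcodeD _ _ (X.D _).ncard_input)
    ⟨_, hcodeD _ _ (X.D _).ncard_output, hdec _⟩ _ (hcodeD x _ (X.D x).ncard_output) _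
    (label_inS_mem hF d) ?_ _ (hcodeD _ _ (X.D _).ncard_input) (hdec x)
  rw [hinside, ← hbetween, hres]
  exact BipartitePole.setCode_input_add_setCode_output (hFB x)


end HalinSnarkData

theorem theorem8p6 (K : Multipole.{u}) (hK : IsHalinSnark K) :
    5 ≤ K.perfectMatchingIndex := by
  obtain ⟨-, X, hX⟩ := hK
  refine five_le_perfectMatchingIndex ?_ ?_
  · obtain ⟨-, fE, -⟩ := hX
    obtain ⟨x, hx⟩ := X.H.exists_trivalent
    obtain ⟨d, rfl⟩ := PlaneCubicTree.exists_dart x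
    have hleaf : ¬ X.H.IsLeaf d.fst := fun h => by
      rw [PlaneCubicTree.IsLeaf, hx] at h
      omega
    have hd : X.inS d ∈ X.parts.ends (X.inV _ hleaf) := by
      rw [HalinSnarkData.ends_inV]
      exact ⟨d, rfl, rfl⟩
    refine ⟨fE.symm ⟨X.inS d, ?_⟩⟩
    rw [show X.parts.vert (X.inS d) = _ from hd]
    simp
  · rintro ⟨F, hF, hcov⟩
    obtain ⟨F', hF', hW, hcov'⟩ := hX.exists_matchingFamily hF hcov
    exact HalinSnarkData.not_isWeldedFamily F' ⟨hF', hW, hcov'⟩
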